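/- An *instruction sequence* is a finite non-empty sequence of primitive instructions: $a$, $+a$, $-a$ (plain basic instruction, positive test, negative test) for a basic instruction $a$; forward jumps $\#l$ ($l\in\mathbb N$); and the termination instruction $!$. The basic instructions are $\mathrm{in}{:}i.\mathrm{get}$, $\mathrm{out}.\mathrm{set}{:}b$, $\mathrm{aux}{:}i.\mathrm{get}$, $\mathrm{aux}{:}i.\mathrm{set}{:}b$ ($i\ge 1$, $b\in\{0,1\}$), acting on Boolean registers; $\mathrm{get}$ replies the content of the register, and $\mathrm{set}{:}b$ makes the content $b$ and replies $b$. After $a$ execution proceeds with the next instruction; after $+a$ (respectively $-a$) it proceeds with the next instruction if the reply is $1$ (respectively $0$) and skips one instruction otherwise; $\#l$ proceeds with the $l$-th next instruction; $!$ terminates. Execution does not terminate properly (inaction) if there is no instruction to proceed with, at $\#0$, and if an instruction addresses a register that is not present. An instruction sequence $X$ *computes* $f:\{0,1\}^n\to\{0,1\}$ if there is a $k\in\mathbb N$ such that, for all $b_1,\dots,b_n\in\{0,1\}$, the execution of $X$ with registers $\mathrm{in}{:}1,\dots,\mathrm{in}{:}n$ containing $b_1,\dots,b_n$ and registers $\mathrm{out},\mathrm{aux}{:}1,\dots,\mathrm{aux}{:}k$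 containing $0$ terminates with content $f(b_1,\dots,b_n)$ of $\mathrm{out}$. Let $\mathrm{nzt}_n(b_1,\dots,b_n)=1$ iff some $b_i=1$. Let $\mathrm{TSTNZ}'_n$ be the instruction sequence $$(-\mathrm{in}{:}1.\mathrm{get};\,+\mathrm{in}{:}2.\mathrm{get};\,\mathrm{out}.\mathrm{set}{:}1);\dots;(-\mathrm{in}{:}(n{-}1).\mathrm{get};\,+\mathrm{in}{:}n.\mathrm{get};\,\mathrm{out}.\mathrm{set}{:}1);\,!$$ if $n$ is even, and $$+\mathrm{in}{:}1.\mathrm{get};\,\mathrm{out}.\mathrm{set}{:}1;\,(-\mathrm{in}{:}2.\mathrm{get};\,+\mathrm{in}{:}3.\mathrm{get};\,\mathrm{out}.\mathrm{set}{:}1);\dots;(-\mathrm{in}{:}(n{-}1).\mathrm{get};\,+\mathrm{in}{:}n.\mathrm{get};\,\mathrm{out}.\mathrm{set}{:}1);\,!$$ if $n$ is odd; its length is $3n/2+1$ or $3(n+1)/2$, respectively. A RAM has registers containing arbitrary integers (initially $0$), direct and indirect addressing, constants, addition and subtraction (no multiplication or division), a conditional jump on a positive register, a read-only input tape and a write-only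 output tape; each executed instruction costs one unit of time (uniform cost). An instruction sequence is given on the input tape with two integers per primitive instruction (one for its form; the other is the index $i$ or the jump length $l$ if the form needs one, and $-1$ otherwise), followed by an end marker. **Theorem.** The problem of deciding, for $n\ge 1$, whether an instruction sequence $X$ with $\mathrm{len}(X)=\mathrm{len}(\mathrm{TSTNZ}'_n)$ computes $\mathrm{nzt}_n$ can be solved in $O(n^2)$ time on a RAM: there are a single RAM program and a function $T(n)=O(n^2)$ such that, for all $n\ge 1$ and all $X$ of that length, the program on input $X$ halts within $T(n)$ steps with output $1$ if $X$ computes $\mathrm{nzt}_n$ and with output $0$ otherwise. -/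

import Mathlib

namespace InSeq

/-! ## Instruction sequences for Boolean registers -/

/-- Names of Boolean registers: `in:i`, `out` and `aux:i`, where `i ≥ 1`. -/
inductive Reg where
  | inp (i : ℕ+)
  | out
  | aux (i : ℕ+)
  deriving DecidableEq

/-- Basic instructions: `in:i.get`, `out.set:b`, `aux:i.get` and `aux:i.set:b`. -/
inductive BInstr where
  | inGet (i : ℕ+)
  | outSet (b : Bool)
  | auxGet (i : ℕ+)
  | auxSet (i : ℕ+) (b : Bool)

/-- Primitive instructions: plain basic instructions `a`, positive tests `+a`, negative tests `-a`,
forward jumps `#l` and the termination instruction `!`. -/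
inductive PInstr where
  | plain (a : BInstr)
  | pos (a : BInstr)
  | neg (a : BInstr)
  | jump (l : ℕ)
  | halt

/-- The contents of the registers of an environment; `none` for a register that the environment
does not have. -/
abbrev Env := Reg → Option Bool

/-- Get the content of a register: the reply is the content and nothing changes. -/
def Env.get (e : Env) (r : Reg) : Option (Bool × Env) :=
  (e r).map fun b => (b, e)

/-- Set the content of a register: the reply is the new content. -/
def Env.set (e : Env) (r : Reg) (b : Bool) : Option (Bool × Env) :=
  (e r).map fun _ => (b, Function.update e r (some b))

/-- The reply of a basic instruction and the environment after its execution; `none` if the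
register it is about is not there. -/
def BInstr.perform : BInstr → Env → Option (Bool × Env)
  | inGet i, e => e.get (.inp i)
  | outSet b, e => e.set .out b
  | auxGet i, e => e.get (.aux i)
  | auxSet i b, e => e.set (.aux i) b

/-- `exec X s e` executes, in the environment `e`, what remains of `X` after its first `s` primitive
instructions have been dropped. The value is the environment at termination, and `none` if inaction
occurs (no instruction to proceed with, a jump `#0`, or a missing register). -/
def exec : List PInstr → ℕ → Env → Option Env
  | [], _, _ => none
  | _ :: X, s + 1, e => exec X s e
  | .plain a :: X, 0, e => (a.perform e).bind fun p => exec X 0 p.2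
  | .pos a :: X, 0, e => (a.perform e).bind fun p => exec X (if p.1 then 0 else 1) p.2
  | .neg a :: X, 0, e => (a.perform e).bind fun p => exec X (if p.1 then 1 else 0) p.2
  | .jump 0 :: _, 0, _ => none
  | .jump (l + 1) :: X, 0, e => exec X l e
  | .halt :: _, 0, e => some e

/-- The initial environment with input registers `in:1, …, in:n` containing `b`, the output register
containing `0`, and auxiliary registers `aux:1, …, aux:k` containing `0`. -/
def initEnv (n k : ℕ) (b : Fin n → Bool) : Env
  | .inp i => if h : (i : ℕ) ≤ n then
      some (b ⟨(i : ℕ) - 1, lt_of_lt_of_le (Nat.sub_lt i.pos Nat.one_pos) h⟩) else none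
  | .out => some false
  | .aux i => if (i : ℕ) ≤ k then some false else none

/-- `X` computes the `n`-ary Boolean function `f`. -/
def Computes {n : ℕ} (X : List PInstr) (f : (Fin n → Bool) → Bool) : Prop :=
  ∃ k : ℕ, ∀ b : Fin n → Bool, ∃ e : Env,
    exec X 0 (initEnv n k b) = some e ∧ e .out = some (f b)

/-- The `n`-bit non-zeroness test. -/
def nzt (n : ℕ) (b : Fin n → Bool) : Bool := decide (∃ i, b i = true)

/-- The instruction sequence `TSTNZ'_n`. -/
def tstnz' (n : ℕ) : List PInstr :=
  if Even n then
    ((List.range (n / 2)).flatMap fun i =>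
      [.neg (.inGet (2 * i).succPNat), .pos (.inGet (2 * i + 1).succPNat),
        .plain (.outSet true)]) ++ [.halt]
  else
    [.pos (.inGet 1), .plain (.outSet true)] ++
    ((List.range ((n - 1) / 2)).flatMap fun i =>
      [.neg (.inGet (2 * i + 1).succPNat), .pos (.inGet (2 * i + 2).succPNat),
        .plain (.outSet true)]) ++ [.halt]

/-! ## Representation of instruction sequences by integers -/

/-- The form of a basic instruction, a number from `1` to `6`. -/
def BInstr.form : BInstr → ℤ
  | inGet _ => 1
  | outSet false => 2
  | outSet true => 3
  | auxGet _ => 4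
  | auxSet _ false => 5
  | auxSet _ true => 6

/-- The number that goes with the form of a basic instruction, and `-1` if none is needed. -/
def BInstr.num : BInstr → ℤ
  | inGet i => (i : ℕ)
  | outSet _ => -1
  | auxGet i => (i : ℕ)
  | auxSet i _ => (i : ℕ)

/-- A primitive instruction as two integers: its form (from `1` to `20`), and a natural number if
its form needs one and `-1` otherwise. -/
def PInstr.code : PInstr → List ℤ
  | plain a => [a.form, a.num]
  | pos a => [a.form + 6, a.num]
  | neg a => [a.form + 12, a.num]
  | jump l => [19, (l : ℤ)]
  | halt => [20, -1]

/-- An instruction sequence as the content of an input tape, with `0` as the end marker. -/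
def encode (X : List PInstr) : List ℤ := X.flatMap PInstr.code ++ [0]

end InSeq

namespace RAM

/-! ## Random access machines, without multiplication and division, with uniform cost -/

/-- RAM instructions. The `i`th register is written `Xᵢ`, where `i ≥ 0`. -/
inductive Instr where
  /-- `Xᵢ ← c` -/
  | const (i : ℕ) (c : ℤ)
  /-- `Xᵢ ← Xⱼ + Xₖ` -/
  | add (i j k : ℕ)
  /-- `Xᵢ ← Xⱼ - Xₖ` -/
  | sub (i j k : ℕ)
  /-- `Xᵢ ←` the content of the register whose index is the content of `Xⱼ` -/
  | load (i j : ℕ)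
  /-- the register whose index is the content of `Xᵢ` gets the content of `Xⱼ` -/
  | store (i j : ℕ)
  /-- transfer control to the `m`th instruction (counted from `0`) if `Xⱼ > 0` -/
  | jumpPos (m j : ℕ)
  /-- `Xᵢ ←` the next integer on the input tape -/
  | read (i : ℕ)
  /-- print the content of `Xᵢ` on the output tape -/
  | print (i : ℕ)
  | halt

/-- A configuration: the index of the instruction to be executed, the contents of the registers,
what remains to be read on the input tape, and the content of the output tape. -/
structure Config where
  pc : ℕ
  mem : ℕ → ℤ
  input : List ℤ
  output : List ℤ

/-- The initial configuration: all registers contain `0` and the output tape is empty. -/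
def init (input : List ℤ) : Config := ⟨0, fun _ => 0, input, []⟩

/-- Continue with the next instruction, after `Xᵢ ← v`. -/
def Config.assign (c : Config) (i : ℕ) (v : ℤ) : Config :=
  { c with pc := c.pc + 1, mem := Function.update c.mem i v }

/-- One step of the program `P`. There is no next configuration at a `halt`, outside the program, at
a negative indirect address, and on reading beyond the end of the input tape. -/
def step (P : List Instr) (c : Config) : Option Config :=
  match P[c.pc]? with
  | none => none
  | some .halt => none
  | some (.const i v) => some (c.assign i v)
  | some (.add i j k) => some (c.assign i (c.mem j + c.mem k))
  | some (.sub i j k) => some (c.assign i (c.mem j - c.mem k))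
  | some (.load i j) => if 0 ≤ c.mem j then some (c.assign i (c.mem (c.mem j).toNat)) else none
  | some (.store i j) => if 0 ≤ c.mem i then some (c.assign (c.mem i).toNat (c.mem j)) else none
  | some (.jumpPos m j) => some { c with pc := if 0 < c.mem j then m else c.pc + 1 }
  | some (.read i) =>
    match c.input with
    | [] => none
    | v :: w => some { c.assign i v with input := w }
  | some (.print i) => some { c with pc := c.pc + 1, output := c.output ++ [c.mem i] }

/-- The configuration after exactly `t` steps, if there is one. -/
def stepN (P : List Instr) : ℕ → Config → Option Config
  | 0, c => some c
  | t + 1, c => (step P c).bind (stepN P t)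

/-- On the given input, the program `P` reaches a `halt` instruction after at most `t` steps, with
output `1` if `A` holds and with output `0` if `A` does not hold. -/
def DecidesWithin (P : List Instr) (input : List ℤ) (A : Prop) (t : ℕ) : Prop :=
  ∃ s ≤ t, ∃ c : Config, stepN P s (init input) = some c ∧ P[c.pc]? = some .halt ∧
    ((A ∧ c.output = [1]) ∨ (¬ A ∧ c.output = [0]))

end RAM

/-!
Consider the execution of a correct `X` when all inputs are `0`. It ends with `0` in `out`, and
changing any single input into `1` must change this, so every input must be tested on the way.
Following this execution (`descent`) shows that three instructions are needed for every two inputs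
(`three_mul_card_sens_le`): the most that is possible is that `-in:a.get; +in:b.get; T` is passed
without executing `T`, and that `T` is reached as soon as `in:a` or `in:b` contains `1`. The length
of `TSTNZ'_n` is the smallest one that this bound allows. Hence (`shape_zero_of_length`,
`shape_one_of_length`) `X` is a sequence of such blocks, of which one has the form `+in:a.get; T` if
`n` is odd, followed by `!`, and every input is tested by exactly one block.

It remains to find out whether the last instructions `T` of the blocks are right. As the blocks
from some point on compute the disjunction of the inputs they test, and never spoil an `out` that
contains `1`, this can be done from right to left (`scan`). Every position gets a kind: `-1` if
execution from there always ends with `1` in `out`, `x > 0` if it does so when `in:x` contains `0`,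
and `0` if there is no such guarantee. The kind of the position of `T` follows from the kinds of the
positions to which `T` leads, and the tests of a block are admissible if their inputs are new and
the kind of `T` is not one of these inputs. A sequence that passes is correct
(`computes_of_accepts`). Conversely, a position of kind `0` does not lead to `1` in `out` when all
later inputs are `0`, and one of kind `x` does not when `in:x` contains `1` and the other later
inputs are `0` (`Scan.Futile`). So inputs with one or two ones refute a sequence that does not pass
(`accepts_of_computes`). The auxiliary registers need no attention: in a sequence that passes, at
most one instruction is about them, and it finds them all containing `0`.

The program `prog` stores its input, with four registers for each position, and performs the scan.
It uses a bounded number of steps for each instruction (`decidesWithin_accepts`), so its running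
time is even linear in `n`.
-/

namespace InSeq

/-! ### Execution -/

/-- The content of `out` at termination; `none` in the case of inaction. -/
def outcome (X : List PInstr) (e : Env) : Option Bool := (exec X 0 e).bind fun e' => e' .out

theorem exec_eq_exec_drop (X : List PInstr) (s : ℕ) (e : Env) :
    exec X s e = exec (X.drop s) 0 e := by
  induction X generalizing s with
  | nil => simp [exec]
  | cons I X ih =>
    cases s with
    | zero => rfl
    | succ s => rw [exec, List.drop_succ_cons, ih]

@[simp] theorem outcome_nil (e : Env) : outcome [] e = none := rfl

@[simp] theorem outcome_halt (X : List PInstr) (e : Env) : outcome (.halt :: X) e = e .out := rfl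

@[simp] theorem outcome_jump_zero (X : List PInstr) (e : Env) :
    outcome (.jump 0 :: X) e = none := rfl

@[simp] theorem outcome_jump_succ (l : ℕ) (X : List PInstr) (e : Env) :
    outcome (.jump (l + 1) :: X) e = outcome (X.drop l) e := by
  rw [outcome, exec, exec_eq_exec_drop, outcome]

theorem outcome_plain (a : BInstr) (X : List PInstr) (e : Env) :
    outcome (.plain a :: X) e = (a.perform e).bind fun p => outcome X p.2 := by
  rw [outcome, exec, Option.bind_assoc]; rfl

theorem outcome_pos (a : BInstr) (X : List PInstr) (e : Env) :
    outcome (.pos a :: X) e =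
      (a.perform e).bind fun p => if p.1 then outcome X p.2 else outcome (X.drop 1) p.2 := by
  rw [outcome, exec, Option.bind_assoc]
  congr 1; funext p; cases p.1
  · simp only [Bool.false_eq_true, if_false, outcome]; rw [exec_eq_exec_drop]
  · simp [outcome]

theorem outcome_neg (a : BInstr) (X : List PInstr) (e : Env) :
    outcome (.neg a :: X) e =
      (a.perform e).bind fun p => if p.1 then outcome (X.drop 1) p.2 else outcome X p.2 := by
  rw [outcome, exec, Option.bind_assoc]
  congr 1; funext p; cases p.1
  · simp [outcome]
  · simp only [if_true, outcome]; rw [exec_eq_exec_drop]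

theorem outcome_pos_inGet {e : Env} {i : ℕ+} {b : Bool} (h : e (.inp i) = some b)
    (X : List PInstr) :
    outcome (.pos (.inGet i) :: X) e = if b then outcome X e else outcome (X.drop 1) e := by
  simp [outcome_pos, BInstr.perform, Env.get, h]

theorem outcome_neg_inGet {e : Env} {i : ℕ+} {b : Bool} (h : e (.inp i) = some b)
    (X : List PInstr) :
    outcome (.neg (.inGet i) :: X) e = if b then outcome (X.drop 1) e else outcome X e := by
  simp [outcome_neg, BInstr.perform, Env.get, h]

/-! ### Changing an input -/

/-- The environment `e` with the content of `in:i` changed into `1`. -/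
def flip (e : Env) (i : ℕ+) : Env := Function.update e (.inp i) (some true)

@[simp] theorem flip_self (e : Env) (i : ℕ+) : flip e i (.inp i) = some true := by simp [flip]

theorem flip_of_ne (e : Env) {i j : ℕ+} (h : j ≠ i) : flip e i (.inp j) = e (.inp j) := by
  simp [flip, h]

@[simp] theorem flip_out (e : Env) (i : ℕ+) : flip e i .out = e .out := by simp [flip]

@[simp] theorem flip_aux (e : Env) (i j : ℕ+) : flip e i (.aux j) = e (.aux j) := by simp [flip]

/-- The input registers of `e` are those with an index in `U`, and they all contain `0`. -/
def ZeroOn (U : Finset ℕ+) (e : Env) : Prop :=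
  ∀ i, e (.inp i) = if i ∈ U then some false else none

/-- The indices of the input registers of which the change from `0` into `1` makes the outcome
`1`. -/
def sens (U : Finset ℕ+) (X : List PInstr) (e : Env) : Finset ℕ+ :=
  U.filter fun i => outcome X (flip e i) = some true

theorem mem_sens {U : Finset ℕ+} {X : List PInstr} {e : Env} {i : ℕ+} :
    i ∈ sens U X e ↔ i ∈ U ∧ outcome X (flip e i) = some true := by
  simp [sens]

/-- An instruction other than a test of an input register acts in the same way whatever the
inputs are. -/
theorem exists_uniform_step {I : PInstr} {X : List PInstr} {e : Env}
    (hp : ∀ x, I ≠ .pos (.inGet x)) (hn : ∀ x, I ≠ .neg (.inGet x))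
    (h : outcome (I :: X) e = some false) :
    I = .halt ∨ ∃ s e', (∀ i, e' (.inp i) = e (.inp i)) ∧
      outcome (I :: X) e = outcome (X.drop s) e' ∧
      ∀ i, outcome (I :: X) (flip e i) = outcome (X.drop s) (flip e' i) := by
  have key : ∀ a : BInstr, (∀ x, a ≠ .inGet x) →
      a.perform e = none ∨ ∃ r e', a.perform e = some (r, e') ∧
        (∀ i, e' (.inp i) = e (.inp i)) ∧ ∀ i, a.perform (flip e i) = some (r, flip e' i) := by
    have hset : ∀ (r : Reg) (b : Bool), (∀ i, r ≠ .inp i) → e.set r b = none ∨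
        ∃ v e', e.set r b = some (v, e') ∧ (∀ i, e' (.inp i) = e (.inp i)) ∧
          ∀ i, (flip e i).set r b = some (v, flip e' i) := by
      intro r b hr
      rcases h : e r with _ | v
      · simp [Env.set, h]
      · refine Or.inr ⟨b, Function.update e r (some b), by simp [Env.set, h], ?_, ?_⟩
        · intro i; simp [Function.update_of_ne (hr i).symm]
        · intro i
          have : flip e i r = some v := by rw [flip, Function.update_of_ne (hr i), h]
          rw [Env.set, this, Option.map_some, flip, flip, Function.update_comm (hr i)]
    intro a ha
    cases a with
    | inGet x => exact absurd rfl (ha x)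
    | outSet b => exact hset _ _ (by simp)
    | auxSet i b => exact hset _ _ (by simp)
    | auxGet j =>
      rcases h : e (.aux j) with _ | v
      · simp [BInstr.perform, Env.get, h]
      · exact Or.inr ⟨v, e, by simp [BInstr.perform, Env.get, h], fun _ => rfl,
          fun i => by simp [BInstr.perform, Env.get, h]⟩
  cases I with
  | halt => exact Or.inl rfl
  | jump l =>
    cases l with
    | zero => simp at h
    | succ l => exact Or.inr ⟨l, e, by simp⟩
  | plain a =>
    by_cases ha : ∃ x, a = .inGet x
    · obtain ⟨x, rfl⟩ := ha
      rcases hx : e (.inp x) with _ | v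
      · simp [outcome_plain, BInstr.perform, Env.get, hx] at h
      · refine Or.inr ⟨0, e, fun _ => rfl, by simp [outcome_plain, BInstr.perform, Env.get, hx], ?_⟩
        intro i
        by_cases hi : x = i
        · subst hi; simp [outcome_plain, BInstr.perform, Env.get]
        · simp [outcome_plain, BInstr.perform, Env.get, flip_of_ne _ hi, hx]
    · rcases key a (fun x hx => ha ⟨x, hx⟩) with h0 | ⟨r, e', h1, h2, h3⟩
      · simp [outcome_plain, h0] at h
      · exact Or.inr ⟨0, e', h2, by simp [outcome_plain, h1], by simp [outcome_plain, h3]⟩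
  | pos a =>
    rcases key a (fun x hx => hp x (by rw [hx])) with h0 | ⟨r, e', h1, h2, h3⟩
    · simp [outcome_pos, h0] at h
    · refine Or.inr ⟨if r then 0 else 1, e', h2, ?_, ?_⟩ <;> cases r <;>
        simp [outcome_pos, h1, h3]
  | neg a =>
    rcases key a (fun x hx => hn x (by rw [hx])) with h0 | ⟨r, e', h1, h2, h3⟩
    · simp [outcome_neg, h0] at h
    · refine Or.inr ⟨if r then 1 else 0, e', h2, ?_, ?_⟩ <;> cases r <;>
        simp [outcome_neg, h1, h3]

theorem ZeroOn.congr {U : Finset ℕ+} {e e' : Env} (h : ZeroOn U e)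
    (h' : ∀ i, e' (.inp i) = e (.inp i)) : ZeroOn U e' := fun i => (h' i).trans (h i)

theorem ZeroOn.mem {U : Finset ℕ+} {e : Env} (h : ZeroOn U e) {i : ℕ+} {b : Bool}
    (hi : e (.inp i) = some b) : i ∈ U ∧ b = false := by
  have := h i
  rw [hi] at this
  split_ifs at this with hU
  exact ⟨hU, by simpa using this⟩

theorem sens_subset_of_uniform {U : Finset ℕ+} {X Y : List PInstr} {e e' : Env}
    (h : ∀ i, outcome X (flip e i) = outcome Y (flip e' i)) : sens U X e ⊆ sens U Y e' := by
  intro i hi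
  rw [mem_sens] at hi ⊢
  rwa [← h i]

/-! ### The shape of short instruction sequences -/

/-- `Shape X V s`: `X` is a sequence of blocks `-in:a.get; +in:b.get; T` and `+in:a.get; T`,
followed by `!`. Here `T` may be any instruction, `V` is the set of the indices `a` and `b`, which
are all different, and `s` is the number of blocks of the second form. -/
inductive Shape : List PInstr → Finset ℕ+ → ℕ → Prop where
  | halt : Shape [.halt] ∅ 0
  | pair {X V s} (a b T) : Shape X V s → b ∉ V → a ∉ insert b V →
      Shape (.neg (.inGet a) :: .pos (.inGet b) :: T :: X) (insert a (insert b V)) s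
  | single {X V s} (a T) : Shape X V s → a ∉ V →
      Shape (.pos (.inGet a) :: T :: X) (insert a V) (s + 1)

theorem outcome_pos_cons_of_false {e : Env} {i : ℕ+} (h : e (.inp i) = some false)
    (T : PInstr) (X : List PInstr) : outcome (.pos (.inGet i) :: T :: X) e = outcome X e := by
  simp [outcome_pos_inGet h]

theorem Shape.outcome_eq {X : List PInstr} {V : Finset ℕ+} {s : ℕ} (h : Shape X V s) {e : Env}
    (he : ∀ i ∈ V, e (.inp i) = some false) : outcome X e = e .out := by
  induction h with
  | halt => rfl
  | pair a b T _ _ _ ih =>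
    rw [outcome_neg_inGet (he a (by simp)), if_neg (by simp),
      outcome_pos_cons_of_false (he b (by simp))]
    exact ih fun i hi => he i (by simp [hi])
  | single a T _ _ ih =>
    rw [outcome_pos_cons_of_false (he a (by simp))]
    exact ih fun i hi => he i (by simp [hi])

/-- How the execution on all zeros begins, together with the input registers whose change may make
a difference in the part that is passed. -/
inductive Descent (U : Finset ℕ+) (X : List PInstr) (e : Env) : Prop where
  | skip (Y e') : ZeroOn U e' → outcome Y e' = some false → Y.length < X.length →
      sens U X e ⊆ sens U Y e' → Descent U X e
  | halt : X = [.halt] → sens U X e = ∅ → Descent U X e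
  | slack : 3 * (sens U X e).card + 4 ≤ 2 * X.length → Descent U X e
  | pair (a b T Y) : X = .neg (.inGet a) :: .pos (.inGet b) :: T :: Y →
      outcome Y e = some false → sens U X e ⊆ insert a (insert b (sens U Y e)) → Descent U X e
  | pos (a T Y) : X = .pos (.inGet a) :: T :: Y → outcome Y e = some false →
      sens U X e ⊆ insert a (sens U Y e) → Descent U X e
  | neg (a T Y s e') : X = .neg (.inGet a) :: T :: Y → ZeroOn U e' →
      outcome (Y.drop s) e' = some false →
      sens U X e ⊆ insert a (sens U (Y.drop s) e') → Descent U X e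

theorem sens_subset_insert {U : Finset ℕ+} {X Y : List PInstr} {e : Env} {a : ℕ+}
    (h : ∀ i, i ≠ a → outcome X (flip e i) = outcome Y (flip e i)) :
    sens U X e ⊆ insert a (sens U Y e) := by
  intro i hi
  rw [Finset.mem_insert]
  by_cases hia : i = a
  · exact Or.inl hia
  · rw [mem_sens, h i hia] at hi
    exact Or.inr (mem_sens.2 hi)

theorem sens_pos_inGet {U : Finset ℕ+} {T : PInstr} {X : List PInstr} {e : Env} {a : ℕ+}
    (ha : e (.inp a) = some false) :
    sens U (.pos (.inGet a) :: T :: X) e ⊆ insert a (sens U X e) :=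
  sens_subset_insert fun i hi =>
    outcome_pos_cons_of_false (by rw [flip_of_ne _ hi.symm, ha]) _ _

theorem sens_neg_inGet {U : Finset ℕ+} {X : List PInstr} {e : Env} {a : ℕ+}
    (ha : e (.inp a) = some false) :
    sens U (.neg (.inGet a) :: X) e ⊆ insert a (sens U X e) :=
  sens_subset_insert fun i hi => by
    rw [outcome_neg_inGet (b := false) (by rw [flip_of_ne _ hi.symm, ha])]; simp

theorem exists_input {X : List PInstr} {e : Env} {a : ℕ+} {b : Bool}
    (h : outcome (.pos (.inGet a) :: X) e = some b ∨ outcome (.neg (.inGet a) :: X) e = some b) :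
    ∃ v, e (.inp a) = some v := by
  rcases hv : e (.inp a) with _ | v
  · simp [outcome_pos, outcome_neg, BInstr.perform, Env.get, hv] at h
  · exact ⟨v, rfl⟩

/-- An induction step along the execution on all zeros. A negative test `-in:a.get` of which the
change of `in:a` makes a difference is treated together with the next instruction `T`: if `T` is a
positive test, then both belong to one block, and otherwise not more than `in:a` is gained by at
least two instructions. -/
theorem descent {U : Finset ℕ+} {X : List PInstr} {e : Env} (hz : ZeroOn U e)
    (h : outcome X e = some false) : Descent U X e := by
  rcases X with _ | ⟨I, X⟩
  · simp at h
  by_cases hp : ∃ a, I = .pos (.inGet a)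
  · obtain ⟨a, rfl⟩ := hp
    obtain ⟨v, hv⟩ := exists_input (Or.inl h)
    obtain ⟨haU, rfl⟩ := hz.mem hv
    rw [outcome_pos_inGet hv] at h
    rcases X with _ | ⟨T, Y⟩
    · simp at h
    · exact .pos a T Y rfl (by simpa using h) (sens_pos_inGet hv)
  by_cases hn : ∃ a, I = .neg (.inGet a)
  · obtain ⟨a, rfl⟩ := hn
    obtain ⟨v, hv⟩ := exists_input (Or.inr h)
    obtain ⟨haU, rfl⟩ := hz.mem hv
    have h' := h
    rw [outcome_neg_inGet hv] at h'
    replace h' : outcome X e = some false := by simpa using h'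
    have hsub : sens U (.neg (.inGet a) :: X) e ⊆ insert a (sens U X e) := sens_neg_inGet hv
    by_cases hcrit : a ∈ sens U (.neg (.inGet a) :: X) e ∧ a ∉ sens U X e
    swap
    · refine .skip X e hz h' (by simp) fun i hi => ?_
      rcases Finset.mem_insert.1 (hsub hi) with rfl | h
      · by_contra h0; exact hcrit ⟨hi, h0⟩
      · exact h
    obtain ⟨hc1, hc2⟩ := hcrit
    have hc1' := (mem_sens.1 hc1).2
    rw [outcome_neg_inGet (flip_self e a), if_pos rfl] at hc1'
    rcases X with _ | ⟨T, Y⟩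
    · simp at h'
    rw [List.drop_succ_cons, List.drop_zero] at hc1'
    by_cases hTp : ∃ b, T = .pos (.inGet b)
    · obtain ⟨b, rfl⟩ := hTp
      obtain ⟨v, hb⟩ := exists_input (Or.inl h')
      obtain ⟨-, rfl⟩ := hz.mem hb
      rw [outcome_pos_inGet hb] at h'
      rcases Y with _ | ⟨T', Y⟩
      · simp at h'
      · refine .pair a b T' Y rfl (by simpa using h') (hsub.trans ?_)
        exact Finset.insert_subset_insert _ (sens_pos_inGet hb)
    by_cases hTn : ∃ b, T = .neg (.inGet b)
    · obtain ⟨b, rfl⟩ := hTn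
      obtain ⟨v, hb⟩ := exists_input (Or.inr h')
      obtain ⟨-, rfl⟩ := hz.mem hb
      by_cases hab : b = a
      · subst hab
        refine .neg b _ Y 0 e rfl hz ?_ (hsub.trans ?_)
        · rw [outcome_neg_inGet hb] at h'; simpa using h'
        · refine (Finset.insert_subset_insert _ (sens_neg_inGet hb)).trans ?_
          simp
      · -- Both executions proceed with `Y` here, so the change of `in:a` makes no difference.
        refine absurd (mem_sens.2 ⟨haU, ?_⟩) hc2
        rw [outcome_neg_inGet (b := false) (by rw [flip_of_ne _ hab, hb])]
        simpa using hc1'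
    rcases exists_uniform_step (fun b hb => hTp ⟨b, hb⟩) (fun b hb => hTn ⟨b, hb⟩) h' with
      rfl | ⟨s, e', h1, h2, h3⟩
    · -- At least four instructions, for one input.
      have hcard : (sens U (.neg (.inGet a) :: .halt :: Y) e).card ≤ 1 := by
        rw [Finset.card_le_one_iff_subset_singleton]
        refine ⟨a, fun i hi => ?_⟩
        rcases Finset.mem_insert.1 (hsub hi) with rfl | h
        · simp
        · rw [mem_sens] at h
          simp at h h'
          simp [h'] at h
      rcases Y with _ | ⟨J, Y⟩
      · simp at hc1'
      rcases Y with _ | ⟨J', Y⟩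
      · exfalso
        simp at h'
        cases J with
        | halt => simp [h'] at hc1'
        | jump l => cases l <;> simp at hc1'
        | plain c => simp [outcome_plain] at hc1'
        | pos c => simp [outcome_pos] at hc1'
        | neg c => simp [outcome_neg] at hc1'
      · exact .slack (by simp only [List.length_cons]; omega)
    · refine .neg a T Y s e' rfl (hz.congr h1) (h2 ▸ h') (hsub.trans ?_)
      exact Finset.insert_subset_insert _ (sens_subset_of_uniform h3)
  · rcases exists_uniform_step (fun b hb => hp ⟨b, hb⟩) (fun b hb => hn ⟨b, hb⟩) h with
      rfl | ⟨s, e', h1, h2, h3⟩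
    · have h0 : sens U (.halt :: X) e = ∅ := by
        rw [Finset.eq_empty_iff_forall_notMem]
        intro i hi
        rw [mem_sens] at hi
        simp at hi h
        simp [h] at hi
      rcases X with _ | ⟨J, X⟩
      · exact .halt rfl h0
      · exact .slack (by simp only [h0, List.length_cons]; simp; omega)
    · exact .skip _ e' (hz.congr h1) (h2 ▸ h) (by simp) (sens_subset_of_uniform h3)

theorem card_insert_insert_le {S : Finset ℕ+} (a b : ℕ+) :
    (insert a (insert b S)).card ≤ S.card + 2 :=
  (Finset.card_insert_le _ _).trans (Nat.succ_le_succ (Finset.card_insert_le _ _))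

/-- Three instructions are needed for every two input registers that matter. -/
theorem three_mul_card_sens_le {U : Finset ℕ+} {X : List PInstr} {e : Env} (hz : ZeroOn U e)
    (h : outcome X e = some false) : 3 * (sens U X e).card + 2 ≤ 2 * X.length := by
  induction hl : X.length using Nat.strong_induction_on generalizing X e with
  | _ l ih =>
    subst hl
    cases descent hz h with
    | skip Y e' hz' h' hlen hs =>
      have := ih _ hlen hz' h' rfl
      have := Finset.card_le_card hs
      omega
    | halt hX hs => subst hX; simp [hs]
    | slack h => omega
    | pair a b T Y hX h' hs =>
      subst hX
      have := ih _ (by simp only [List.length_cons]; omega) hz h' rfl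
      have := (Finset.card_le_card hs).trans (card_insert_insert_le a b)
      simp only [List.length_cons]; omega
    | pos a T Y hX h' hs =>
      subst hX
      have := ih _ (by simp only [List.length_cons]; omega) hz h' rfl
      have := (Finset.card_le_card hs).trans (Finset.card_insert_le _ _)
      simp only [List.length_cons]; omega
    | neg a T Y s e' hX hz' h' hs =>
      subst hX
      have := ih _ (by simp only [List.length_cons, List.length_drop]; omega) hz' h' rfl
      have := (Finset.card_le_card hs).trans (Finset.card_insert_le _ _)
      simp only [List.length_cons, List.length_drop] at *; omega

theorem eq_insert_insert_of_card {S S' : Finset ℕ+} {a b : ℕ+} (hs : S ⊆ insert a (insert b S'))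
    (hc : S'.card + 2 ≤ S.card) : S = insert a (insert b S') ∧ b ∉ S' ∧ a ∉ insert b S' := by
  have h1 := Finset.eq_of_subset_of_card_le hs ((card_insert_insert_le a b).trans hc)
  refine ⟨h1, fun hb => ?_, fun ha => ?_⟩
  · rw [h1, Finset.insert_eq_of_mem hb] at hc
    have := Finset.card_insert_le a S'
    omega
  · rw [h1, Finset.insert_eq_of_mem ha] at hc
    have := Finset.card_insert_le b S'
    omega

theorem eq_insert_of_card {S S' : Finset ℕ+} {a : ℕ+} (hs : S ⊆ insert a S')
    (hc : S'.card + 1 ≤ S.card) : S = insert a S' ∧ a ∉ S' := by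
  have h1 := Finset.eq_of_subset_of_card_le hs ((Finset.card_insert_le _ _).trans hc)
  refine ⟨h1, fun ha => ?_⟩
  rw [h1, Finset.insert_eq_of_mem ha] at hc
  omega

/-- An instruction sequence that attains the lower bound consists of blocks for two input
registers. -/
theorem shape_zero_of_length {U : Finset ℕ+} {X : List PInstr} {e : Env} (hz : ZeroOn U e)
    (h : outcome X e = some false) (hl : 2 * X.length = 3 * (sens U X e).card + 2) :
    Shape X (sens U X e) 0 := by
  induction hn : X.length using Nat.strong_induction_on generalizing X with
  | _ n ih =>
    subst hn
    cases descent hz h with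
    | skip Y e' hz' h' hlen hs =>
      have := three_mul_card_sens_le hz' h'
      have := Finset.card_le_card hs
      omega
    | halt hX hs => rw [hs, hX]; exact .halt
    | slack h => omega
    | pair a b T Y hX h' hs =>
      subst hX
      have h1 := three_mul_card_sens_le hz h'
      have h2 := (Finset.card_le_card hs).trans (card_insert_insert_le a b)
      simp only [List.length_cons] at hl ih
      obtain ⟨h3, h4, h5⟩ := eq_insert_insert_of_card hs (by omega)
      rw [h3]
      exact .pair a b T (ih _ (by omega) h' (by omega) rfl) h4 h5
    | pos a T Y hX h' hs =>
      subst hX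
      have := three_mul_card_sens_le hz h'
      have := (Finset.card_le_card hs).trans (Finset.card_insert_le _ _)
      simp only [List.length_cons] at hl; omega
    | neg a T Y s e' hX hz' h' hs =>
      subst hX
      have := three_mul_card_sens_le hz' h'
      have := (Finset.card_le_card hs).trans (Finset.card_insert_le _ _)
      simp only [List.length_cons, List.length_drop] at *; omega

/-- An instruction sequence that misses the lower bound by a half consists of blocks for two input
registers and one block for a single input register. -/
theorem shape_one_of_length {U : Finset ℕ+} {X : List PInstr} {e : Env} (hz : ZeroOn U e)
    (ho : e .out = some false) (h : outcome X e = some false)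
    (hl : 2 * X.length = 3 * (sens U X e).card + 3) : Shape X (sens U X e) 1 := by
  induction hn : X.length using Nat.strong_induction_on generalizing X with
  | _ n ih =>
    subst hn
    cases descent hz h with
    | skip Y e' hz' h' hlen hs =>
      have := three_mul_card_sens_le hz' h'
      have := Finset.card_le_card hs
      omega
    | halt hX hs => simp [hX] at hl
    | slack h => omega
    | pair a b T Y hX h' hs =>
      subst hX
      have h1 := three_mul_card_sens_le hz h'
      have h2 := (Finset.card_le_card hs).trans (card_insert_insert_le a b)
      simp only [List.length_cons] at hl ih
      obtain ⟨h3, h4, h5⟩ := eq_insert_insert_of_card hs (by omega)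
      rw [h3]
      exact .pair a b T (ih _ (by omega) h' (by omega) rfl) h4 h5
    | pos a T Y hX h' hs =>
      subst hX
      have := three_mul_card_sens_le hz h'
      have := (Finset.card_le_card hs).trans (Finset.card_insert_le _ _)
      simp only [List.length_cons] at hl
      obtain ⟨h3, h4⟩ := eq_insert_of_card hs (by omega)
      rw [h3]
      exact .single a T (shape_zero_of_length hz h' (by omega)) h4
    | neg a T Y s e' hX hz' h' hs =>
      subst hX
      exfalso
      have h1 := three_mul_card_sens_le hz' h'
      have h2 := (Finset.card_le_card hs).trans (Finset.card_insert_le _ _)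
      simp only [List.length_cons, List.length_drop] at hl h1
      obtain rfl : s = 0 := by omega
      obtain ⟨h3, h4⟩ := eq_insert_of_card hs (by omega)
      rw [List.drop_zero] at h' h3 h4 h1 h2
      have hS := shape_zero_of_length hz' h' (by omega)
      -- With `in:a` containing `1`, the instruction `T` is skipped, so `out` keeps its content.
      have ha := (mem_sens.1 (h3 ▸ Finset.mem_insert_self a _)).2
      rw [outcome_neg_inGet (flip_self e a), if_pos rfl, List.drop_succ_cons, List.drop_zero,
        hS.outcome_eq, flip_out, ho] at ha
      · simp at ha
      · intro i hi
        rw [flip_of_ne _ (by rintro rfl; exact h4 hi), hz i, if_pos (mem_sens.1 hi).1]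

/-! ### Reading an instruction sequence from right to left -/

/-- A classification of the primitive instructions by what they do when `out` and the auxiliary
registers contain `0`: `1` and `2` for setting `out` to `1` (`2` if the next instruction is skipped
as well), `3` for skipping the next instruction, `4`, `5`, `6` and `7` for positive tests of inputs,
jumps, negative tests of inputs and termination. The other instructions, of class `0`, cannot occur
in a shortest instruction sequence for the non-zeroness test. -/
def PInstr.cls : PInstr → ℕ
  | plain (.outSet true) => 1
  | pos (.outSet true) => 1
  | neg (.outSet true) => 2
  | pos (.outSet false) => 3
  | pos (.auxGet _) => 3
  | pos (.auxSet _ false) => 3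
  | neg (.auxSet _ true) => 3
  | pos (.inGet _) => 4
  | jump _ => 5
  | neg (.inGet _) => 6
  | halt => 7
  | _ => 0

/-- The second integer of the code of a primitive instruction. -/
def PInstr.num : PInstr → ℤ
  | plain a => a.num
  | pos a => a.num
  | neg a => a.num
  | jump l => l
  | halt => -1

/-- The index or jump length of a primitive instruction, if it has one. -/
def PInstr.arg (I : PInstr) : ℕ := I.num.toNat

/-- What is expected when an instruction sequence is read from right to left: the final `!`, the
last instruction of a block, the instruction `+in:i.get` before it, or, after that one, either
`-in:i.get` or the last instruction of the preceding block. -/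
inductive Phase where
  | term
  | act
  | pos
  | opt
  deriving DecidableEq

/-- What is known of a suffix of an instruction sequence. -/
structure Scan where
  phase : Phase
  /-- Has a block with a single test been completed? -/
  used : Bool
  /-- The kind of the last instruction of the current block. -/
  cur : ℤ
  /-- The kinds of the positions: `-1` if execution from there always ends with `1` in `out`,
  `x > 0` if this is so when `in:x` contains `0`, and `0` if it is useless to jump there. -/
  kinds : List ℤ
  /-- The indices of the input registers tested by the blocks. -/
  seen : Finset ℕ
  /-- An upper bound for the indices of input registers. -/
  mx : ℕ

/-- The kind of the position at distance `d` from the instruction before the suffix. -/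
def Scan.kindAt (σ : Scan) (d : ℕ) : ℤ := (0 :: σ.kinds).getD d 0

/-- The kind of the position of `I` when `I` is the last instruction of a block, so that the next
position is the start of a block or the final `!`. In class `2`, there must be an instruction left
after the one that is skipped. In the classes `3` and `4`, the instruction skips the first
instruction of the next block, so the kind of the position at distance `2` matters. A positive test
of `in:x` proceeds with the next block if `in:x` contains `1`, which ends with `1` in `out` if that
block or a later one tests `in:x`. A jump to a position of kind `x` is useless if `in:x` is tested
by a later block, for execution must succeed when `in:x` contains `1`. -/
def Scan.kindOf (σ : Scan) (I : PInstr) : ℤ :=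
  match I.cls with
  | 1 => -1
  | 2 => if 2 ≤ σ.kinds.length then -1 else 0
  | 3 => if σ.kindAt 2 < 0 then -1 else 0
  | 4 => if σ.kindAt 2 < 0 then (if I.arg ∈ σ.seen then -1 else (I.arg : ℤ)) else 0
  | 5 => if 0 < σ.kindAt I.arg ∧ (σ.kindAt I.arg).toNat ∈ σ.seen then 0 else σ.kindAt I.arg
  | _ => 0

/-- Read `I` as the last instruction of a block; `u` tells whether a block with a single test has
been completed. -/
def Scan.action (σ : Scan) (I : PInstr) (u : Bool) : Option Scan :=
  if σ.kindOf I = 0 then none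
  else some ⟨.pos, u, σ.kindOf I, σ.kindOf I :: σ.kinds, σ.seen,
    if I.cls = 4 then max σ.mx I.arg else σ.mx⟩

/-- Read a test of `in:x` that belongs to a block. It must be the only test of `in:x`, and the
last instruction of the block must succeed when `in:x` contains `1`, so its kind must not be `x`. -/
def Scan.test (σ : Scan) (x : ℕ) (ph : Phase) : Option Scan :=
  if x ∈ σ.seen ∨ σ.cur = x then none
  else some ⟨ph, σ.used, σ.cur, 0 :: σ.kinds, insert x σ.seen, max σ.mx x⟩

/-- Read one more instruction. -/
def Scan.step (I : PInstr) (σ : Scan) : Option Scan :=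
  match σ.phase with
  | .term => if I.cls = 7 then some { σ with phase := .act, kinds := 0 :: σ.kinds } else none
  | .act => σ.action I σ.used
  | .pos => if I.cls = 4 then σ.test I.arg .opt else none
  | .opt => if I.cls = 6 then σ.test I.arg .act
      else if σ.used then none else σ.action I true

/-- Read an instruction sequence from right to left. -/
def scan : List PInstr → Option Scan
  | [] => some ⟨.term, false, 0, [], ∅, 0⟩
  | I :: X => (scan X).bind (Scan.step I)

/-- The condition under which an instruction sequence that has been read is accepted: the last block
is complete, at most one block has a single test, and the inputs tested, which are different, are
`in:1, …, in:n`. -/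
def Scan.Accepts (σ : Scan) : Prop :=
  (σ.phase = .act ∨ σ.phase = .opt ∧ σ.used = false) ∧ σ.mx ≤ σ.seen.card

theorem eq_pos_of_cls {I : PInstr} (h : I.cls = 4) : ∃ x, I = .pos (.inGet x) := by
  unfold PInstr.cls at h; split at h <;> simp_all

theorem eq_jump_of_cls {I : PInstr} (h : I.cls = 5) : ∃ l, I = .jump l := by
  unfold PInstr.cls at h; split at h <;> simp_all

theorem eq_neg_of_cls {I : PInstr} (h : I.cls = 6) : ∃ x, I = .neg (.inGet x) := by
  unfold PInstr.cls at h; split at h <;> simp_all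

theorem eq_halt_of_cls {I : PInstr} (h : I.cls = 7) : I = .halt := by
  unfold PInstr.cls at h; split at h <;> simp_all

@[simp] theorem arg_pos_inGet (x : ℕ+) : (PInstr.pos (.inGet x)).arg = x := rfl

@[simp] theorem arg_neg_inGet (x : ℕ+) : (PInstr.neg (.inGet x)).arg = x := rfl

@[simp] theorem arg_jump (l : ℕ) : (PInstr.jump l).arg = l := rfl

/-- `I` is not about an auxiliary register. -/
def PInstr.AuxFree : PInstr → Prop
  | plain (.auxGet _) | pos (.auxGet _) | neg (.auxGet _) => False
  | plain (.auxSet _ _) | pos (.auxSet _ _) | neg (.auxSet _ _) => False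
  | _ => True

/-- If `I` is about an auxiliary register, then it is there, and contains `0` if `I` gets its
content. -/
def PInstr.AuxFits (e : Env) : PInstr → Prop
  | plain (.auxGet i) | pos (.auxGet i) | neg (.auxGet i) => e (.aux i) = some false
  | plain (.auxSet i _) | pos (.auxSet i _) | neg (.auxSet i _) => (e (.aux i)).isSome
  | _ => True

theorem PInstr.AuxFree.auxFits {I : PInstr} (h : I.AuxFree) (e : Env) : I.AuxFits e := by
  unfold PInstr.AuxFree at h
  unfold PInstr.AuxFits
  split <;> simp_all

/-- In the environment `e`, the input registers have the contents `b`, and no register needed by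
`X` is missing. -/
structure Fits (n : ℕ) (b : ℕ → Bool) (X : List PInstr) (e : Env) : Prop where
  inp : ∀ i : ℕ+, (i : ℕ) ≤ n → e (.inp i) = some (b i)
  out : (e .out).isSome
  aux : ∀ I ∈ X, I.AuxFits e

theorem Fits.tail {n : ℕ} {b : ℕ → Bool} {I : PInstr} {X : List PInstr} {e : Env}
    (h : Fits n b (I :: X) e) : Fits n b X e :=
  ⟨h.inp, h.out, fun J hJ => h.aux J (List.mem_cons_of_mem _ hJ)⟩

theorem Fits.update_out {n : ℕ} {b : ℕ → Bool} {X : List PInstr} {e : Env}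
    (h : Fits n b X e) (v : Bool) : Fits n b X (Function.update e .out (some v)) := by
  refine ⟨fun i hi => by simp [h.inp i hi], by simp, fun J hJ => ?_⟩
  have := h.aux J hJ
  unfold PInstr.AuxFits at this ⊢
  split at this <;> simp_all

theorem Fits.outcome_of_cls_one {n : ℕ} {b : ℕ → Bool} {I : PInstr} {X : List PInstr} {e : Env}
    (h : Fits n b (I :: X) e) (hI : I.cls = 1) :
    outcome (I :: X) e = outcome X (Function.update e .out (some true)) := by
  obtain ⟨v, hv⟩ := Option.isSome_iff_exists.1 h.out
  unfold PInstr.cls at hI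
  split at hI <;> simp_all [outcome_plain, outcome_pos, BInstr.perform, Env.set]

theorem Fits.outcome_of_cls_two {n : ℕ} {b : ℕ → Bool} {I : PInstr} {X : List PInstr} {e : Env}
    (h : Fits n b (I :: X) e) (hI : I.cls = 2) :
    outcome (I :: X) e = outcome (X.drop 1) (Function.update e .out (some true)) := by
  obtain ⟨v, hv⟩ := Option.isSome_iff_exists.1 h.out
  unfold PInstr.cls at hI
  split at hI <;> simp_all [outcome_neg, BInstr.perform, Env.set]

theorem Fits.outcome_of_cls_three {n : ℕ} {b : ℕ → Bool} {I : PInstr} {X : List PInstr} {e : Env}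
    (h : Fits n b (I :: X) e) (hI : I.cls = 3) (hX : ∀ J ∈ X, J.AuxFree) :
    ∃ e', Fits n b X e' ∧ outcome (I :: X) e = outcome (X.drop 1) e' := by
  obtain ⟨v, hv⟩ := Option.isSome_iff_exists.1 h.out
  have hfit := h.aux I (by simp)
  unfold PInstr.cls at hI
  split at hI <;> try contradiction
  · exact ⟨_, h.tail.update_out false, by simp [outcome_pos, BInstr.perform, Env.set, hv]⟩
  · simp only [PInstr.AuxFits] at hfit
    exact ⟨e, h.tail, by simp [outcome_pos, BInstr.perform, Env.get, hfit]⟩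
  · rename_i i
    simp only [PInstr.AuxFits] at hfit
    obtain ⟨w, hw⟩ := Option.isSome_iff_exists.1 hfit
    refine ⟨Function.update e (.aux i) (some false), ⟨fun j hj => by simp [h.inp j hj],
      by simp [h.out], fun J hJ => (hX J hJ).auxFits _⟩, ?_⟩
    simp [outcome_pos, BInstr.perform, Env.set, hw]
  · rename_i i
    simp only [PInstr.AuxFits] at hfit
    obtain ⟨w, hw⟩ := Option.isSome_iff_exists.1 hfit
    refine ⟨Function.update e (.aux i) (some true), ⟨fun j hj => by simp [h.inp j hj],
      by simp [h.out], fun J hJ => (hX J hJ).auxFits _⟩, ?_⟩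
    simp [outcome_neg, BInstr.perform, Env.set, hw]

/-- Twice the length of the suffix minus three times the number of inputs tested in it: `2` for the
final `!`, `2` or `1` for a block of which one or two instructions have been read, and `1` for a
completed block with a single test. -/
def Scan.excess (σ : Scan) : ℕ :=
  (match σ.phase with
    | .term => 0
    | .act => 2
    | .pos => 4
    | .opt => 3) + if σ.used then 1 else 0

theorem Scan.kindOf_cases {σ : Scan} {I : PInstr} (h : σ.kindOf I ≠ 0) :
    I.cls = 1 ∧ σ.kindOf I = -1 ∨
    I.cls = 2 ∧ 2 ≤ σ.kinds.length ∧ σ.kindOf I = -1 ∨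
    I.cls = 3 ∧ σ.kindAt 2 < 0 ∧ σ.kindOf I = -1 ∨
    I.cls = 4 ∧ σ.kindAt 2 < 0 ∧ I.arg ∈ σ.seen ∧ σ.kindOf I = -1 ∨
    I.cls = 4 ∧ σ.kindAt 2 < 0 ∧ I.arg ∉ σ.seen ∧ σ.kindOf I = I.arg ∨
    I.cls = 5 ∧ σ.kindOf I = σ.kindAt I.arg ∧
      ¬ (0 < σ.kindAt I.arg ∧ (σ.kindAt I.arg).toNat ∈ σ.seen) := by
  unfold kindOf at h ⊢
  split at h <;> try split_ifs at h <;> try contradiction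
  all_goals simp_all

theorem Scan.action_eq_some {σ σ' : Scan} {I : PInstr} {u : Bool} (h : σ.action I u = some σ') :
    σ.kindOf I ≠ 0 ∧ σ' = ⟨.pos, u, σ.kindOf I, σ.kindOf I :: σ.kinds, σ.seen,
      if I.cls = 4 then max σ.mx I.arg else σ.mx⟩ := by
  rw [Scan.action] at h
  by_cases hk : σ.kindOf I = 0
  · simp [hk] at h
  · rw [if_neg hk, Option.some_inj] at h
    exact ⟨hk, h.symm⟩

theorem Scan.test_eq_some {σ σ' : Scan} {x : ℕ} {ph : Phase} (h : σ.test x ph = some σ') :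
    x ∉ σ.seen ∧ σ.cur ≠ x ∧
      σ' = ⟨ph, σ.used, σ.cur, 0 :: σ.kinds, insert x σ.seen, max σ.mx x⟩ := by
  rw [Scan.test] at h
  split_ifs at h with hk
  push Not at hk
  exact ⟨hk.1, hk.2, (Option.some_inj.1 h).symm⟩

/-- The invariants of `scan` that do not refer to execution. The instructions of the classes `3` and
`4`, which are those that may concern auxiliary registers or give rise to positive kinds, need a
position of negative kind at distance `2`. As the second instruction of a block with two tests has
kind `0`, they occur only as the last instruction of the block before the one with a single test,
which is when `used` becomes `true`. -/
structure Scan.WF (X : List PInstr) (σ : Scan) : Prop where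
  length_kinds : σ.kinds.length = X.length
  length : 2 * X.length = 3 * σ.seen.card + σ.excess
  seen_pos : ∀ x ∈ σ.seen, 0 < x
  seen_le : ∀ x ∈ σ.seen, x ≤ σ.mx
  kinds_le : ∀ k ∈ σ.kinds, k ≤ σ.mx
  cur_notMem : σ.phase = .pos ∨ σ.phase = .opt → ∀ x ∈ σ.seen, σ.cur ≠ x
  cur_ne : σ.phase = .pos ∨ σ.phase = .opt → σ.cur ≠ 0
  kinds_pos : σ.phase = .pos → σ.kinds.getD 0 0 = σ.cur
  kinds_opt : σ.phase = .opt → σ.kinds.getD 0 0 = 0 ∧ σ.kinds.getD 1 0 = σ.cur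
  kinds_act : σ.phase = .act → σ.kinds.getD 1 0 = 0
  nonpos : σ.used = false → ∀ k ∈ σ.kinds, k ≤ 0
  auxFree : σ.used = false → ∀ I ∈ X, I.AuxFree
  term : σ.phase = .term → X = [] ∧ σ.used = false

theorem Scan.kindAt_le {σ : Scan} {X : List PInstr} (h : σ.WF X) (d : ℕ) :
    σ.kindAt d ≤ σ.mx ∧ (σ.used = false → σ.kindAt d ≤ 0) := by
  rw [kindAt, List.getD_eq_getElem?_getD]
  rcases hd : (0 :: σ.kinds)[d]? with _ | k
  · simp
  · have := List.mem_of_getElem? hd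
    rw [List.mem_cons] at this
    rcases this with rfl | hk
    · simp
    · exact ⟨h.kinds_le k hk, fun hu => h.nonpos hu k hk⟩

theorem Scan.WF.action {σ σ' : Scan} {X : List PInstr} {I : PInstr} {u : Bool} (h : σ.WF X)
    (hph : σ.phase = .act ∧ u = σ.used ∨ σ.phase = .opt ∧ σ.used = false ∧ u = true)
    (hσ : σ.action I u = some σ') : σ'.WF (I :: X) := by
  obtain ⟨hk, rfl⟩ := Scan.action_eq_some hσ
  have hcases := Scan.kindOf_cases hk
  have hmx : σ.mx ≤ if I.cls = 4 then max σ.mx I.arg else σ.mx := by split_ifs <;> omega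
  have hle : σ.kindOf I ≤ ((if I.cls = 4 then max σ.mx I.arg else σ.mx : ℕ) : ℤ) := by
    have := (Scan.kindAt_le h I.arg).1
    rcases hcases with h | h | h | h | ⟨h, -, -, h'⟩ | h
    · omega
    · omega
    · omega
    · omega
    · rw [if_pos h, h']; push_cast; exact le_max_right _ _
    · omega
  have hact : σ.phase = .act → I.cls ≠ 3 ∧ I.cls ≠ 4 := by
    intro h1
    have h2 : σ.kindAt 2 = 0 := h.kinds_act h1
    omega
  refine ⟨?_, ?_, h.seen_pos, fun x hx => (h.seen_le x hx).trans hmx, ?_, ?_, fun _ => hk,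
    fun _ => rfl, by simp, by simp, ?_, ?_, by simp⟩
  · simp [h.length_kinds]
  · have := h.length
    rcases hph with ⟨h1, rfl⟩ | ⟨h1, h2, rfl⟩
    · simp only [Scan.excess, h1, List.length_cons] at this ⊢; omega
    · simp [Scan.excess, h1, h2] at this ⊢; omega
  · intro k hk'
    rcases List.mem_cons.1 hk' with rfl | hk'
    · exact hle
    · exact (h.kinds_le k hk').trans (by exact_mod_cast hmx)
  · intro _ x hx hx'
    replace hx' : σ.kindOf I = x := hx'
    rcases hcases with h1 | h1 | h1 | h1 | ⟨-, -, h1, h2⟩ | ⟨-, h1, h2⟩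
    · omega
    · omega
    · omega
    · omega
    · exact h1 (by rwa [Int.natCast_inj.1 (h2.symm.trans hx')])
    · have := h.seen_pos x hx
      rw [← h1, hx'] at h2
      exact h2 ⟨by omega, by simpa using hx⟩
  · intro hu k hk'
    rcases hph with ⟨h1, rfl⟩ | ⟨h1, h2, rfl⟩
    swap
    · simp at hu
    rcases List.mem_cons.1 hk' with rfl | hk'
    · have := (Scan.kindAt_le h I.arg).2 hu
      have := hact h1
      omega
    · exact h.nonpos hu k hk'
  · intro hu J hJ
    rcases hph with ⟨h1, rfl⟩ | ⟨h1, h2, rfl⟩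
    swap
    · simp at hu
    rcases List.mem_cons.1 hJ with rfl | hJ
    · have := hact h1
      have h0 : J.cls ≠ 0 := by omega
      unfold PInstr.AuxFree
      split <;> simp_all [PInstr.cls] <;> split at h0 <;> simp_all
    · exact h.auxFree hu J hJ

theorem Scan.WF.test {σ σ' : Scan} {X : List PInstr} {I : PInstr} {x : ℕ+} {ph : Phase}
    (h : σ.WF X)
    (hph : σ.phase = .pos ∧ ph = .opt ∨ σ.phase = .opt ∧ ph = .act)
    (hI : I = .pos (.inGet x) ∨ I = .neg (.inGet x))
    (hσ : σ.test x ph = some σ') : σ'.WF (I :: X) := by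
  obtain ⟨hk1, hk2, rfl⟩ := Scan.test_eq_some hσ
  have hph' : σ.phase = .pos ∨ σ.phase = .opt := by tauto
  refine ⟨?_, ?_, ?_, ?_, ?_, ?_, fun _ => h.cur_ne hph', ?_, ?_, ?_, ?_, ?_,
    by rcases hph with ⟨h1, rfl⟩ | ⟨h1, rfl⟩ <;> simp⟩
  · simp [h.length_kinds]
  · have := h.length
    rcases hph with ⟨h1, rfl⟩ | ⟨h1, rfl⟩ <;>
      simp [Scan.excess, h1, hk1] at this ⊢ <;> omega
  · intro y hy
    rcases Finset.mem_insert.1 hy with rfl | hy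
    · exact x.pos
    · exact h.seen_pos y hy
  · intro y hy
    rcases Finset.mem_insert.1 hy with rfl | hy
    · exact le_max_right _ _
    · exact (h.seen_le y hy).trans (le_max_left _ _)
  · intro k hk'
    rcases List.mem_cons.1 hk' with rfl | hk'
    · simp
    · exact (h.kinds_le k hk').trans (by push_cast; exact le_max_left _ _)
  · intro _ y hy
    rcases Finset.mem_insert.1 hy with rfl | hy
    · exact hk2
    · exact h.cur_notMem hph' y hy
  · rcases hph with ⟨h1, rfl⟩ | ⟨h1, rfl⟩ <;> simp
  · rcases hph with ⟨h1, rfl⟩ | ⟨h1, rfl⟩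
    · intro _; exact ⟨rfl, h.kinds_pos h1⟩
    · simp
  · rcases hph with ⟨h1, rfl⟩ | ⟨h1, rfl⟩
    · simp
    · intro _; exact (h.kinds_opt h1).1
  · intro hu k hk'
    rcases List.mem_cons.1 hk' with rfl | hk'
    · exact le_rfl
    · exact h.nonpos hu k hk'
  · intro hu J hJ
    rcases List.mem_cons.1 hJ with rfl | hJ
    · rcases hI with rfl | rfl <;> exact trivial
    · exact h.auxFree hu J hJ

theorem scan_wf {X : List PInstr} {σ : Scan} (h : scan X = some σ) : σ.WF X := by
  induction X generalizing σ with
  | nil =>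
    simp only [scan, Option.some_inj] at h
    subst h
    constructor <;> simp [Scan.excess]
  | cons I X ih =>
    rw [scan, Option.bind_eq_some_iff] at h
    obtain ⟨τ, hτ, h⟩ := h
    have hw := ih hτ
    unfold Scan.step at h
    split at h
    · rename_i hph
      split_ifs at h with hc
      rw [Option.some_inj] at h
      subst h
      obtain rfl := eq_halt_of_cls hc
      obtain ⟨rfl, hu⟩ := hw.term hph
      have hk : τ.kinds = [] := List.eq_nil_of_length_eq_zero hw.length_kinds
      have hs : τ.seen = ∅ := by
        have := hw.length
        simpa [Scan.excess, hph, hu] using this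
      constructor <;> simp [Scan.excess, hu, hk, hs, PInstr.AuxFree]
    · rename_i hph
      exact hw.action (Or.inl ⟨hph, rfl⟩) h
    · rename_i hph
      split_ifs at h with hc
      obtain ⟨x, rfl⟩ := eq_pos_of_cls hc
      exact hw.test (Or.inl ⟨hph, rfl⟩) (Or.inl rfl) h
    · rename_i hph
      split_ifs at h with hc hu
      · obtain ⟨x, rfl⟩ := eq_neg_of_cls hc
        exact hw.test (Or.inr ⟨hph, rfl⟩) (Or.inr rfl) h
      · exact hw.action (Or.inr ⟨hph, by simpa using hu, rfl⟩) h

/-! ### Accepted instruction sequences are correct -/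

/-- For the inputs `b`, execution from a position of kind `k` ends with `1` in `out`. -/
def Favors (b : ℕ → Bool) (k : ℤ) : Prop := k < 0 ∨ 0 < k ∧ b k.toNat = false

/-- All inputs on which kinds depend, but which are not yet tested by the blocks, are `0`. -/
def Scan.Resolved (σ : Scan) (b : ℕ → Bool) : Prop :=
  ∀ k ∈ σ.kinds, 0 < k → k.toNat ∉ σ.seen → b k.toNat = false

/-- What `scan` guarantees about execution for the inputs `b`: once `out` contains `1`, execution
ends with `1` in `out`; the kinds are right; and from the start of a block, the disjunction of the
inputs tested by the blocks is computed. -/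
structure Scan.Sound (n : ℕ) (b : ℕ → Bool) (X : List PInstr) (σ : Scan) : Prop where
  safe : ∀ p < X.length, ∀ e, Fits n b X e → e .out = some true →
    outcome (X.drop p) e = some true
  favors : ∀ p, Favors b (σ.kinds.getD p 0) → ∀ e, Fits n b X e →
    outcome (X.drop p) e = some true
  disj : σ.phase = .act ∨ σ.phase = .opt → σ.Resolved b → ∀ e, Fits n b X e →
    e .out = some false → outcome X e = some (decide (∃ x ∈ σ.seen, b x = true))
  disj_tail : σ.phase = .pos → σ.Resolved b → ∀ e, Fits n b X e →
    e .out = some false → outcome (X.drop 1) e = some (decide (∃ x ∈ σ.seen, b x = true))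

theorem Scan.exists_of_kindAt_ne_zero {σ : Scan} {d : ℕ} (h : σ.kindAt d ≠ 0) :
    ∃ p, d = p + 1 ∧ p < σ.kinds.length ∧ σ.kinds.getD p 0 = σ.kindAt d := by
  cases d with
  | zero => exact absurd rfl h
  | succ p =>
    refine ⟨p, rfl, ?_, rfl⟩
    by_contra hp
    apply h
    simp [kindAt, List.getElem?_eq_none (not_lt.1 hp)]

theorem Scan.Sound.action {n : ℕ} {b : ℕ → Bool} {X : List PInstr} {σ σ' : Scan} {I : PInstr}
    {u : Bool} (hs : σ.Sound n b X) (hw : σ.WF X)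
    (hph : σ.phase = .act ∧ u = σ.used ∨ σ.phase = .opt ∧ σ.used = false ∧ u = true)
    (hσ : σ.action I u = some σ') (hn : σ'.mx ≤ n) : σ'.Sound n b (I :: X) := by
  obtain ⟨hk, rfl⟩ := Scan.action_eq_some hσ
  have hph' : σ.phase = .act ∨ σ.phase = .opt := by tauto
  have hlen : 0 < X.length := by
    have := hw.length
    rcases hph' with h | h <;> simp [Scan.excess, h] at this <;> omega
  have hused : σ.kindAt 2 < 0 → σ.used = false := by
    intro h2
    rcases hph with ⟨h1, -⟩ | ⟨-, h1, -⟩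
    · have : σ.kindAt 2 = 0 := hw.kinds_act h1
      omega
    · exact h1
  have hskip : σ.kindAt 2 < 0 → ∀ e, Fits n b X e → outcome (X.drop 1) e = some true :=
    fun h2 => hs.favors 1 (Or.inl h2)
  have hin : ∀ x : ℕ+, I = .pos (.inGet x) → σ.kindAt 2 < 0 → ∀ e, Fits n b (I :: X) e →
      (e .out = some true ∨ (x : ℕ) ∈ σ.seen ∨ b x = false) →
      outcome (I :: X) e = some true := by
    rintro x rfl h2 e he hc
    have hx : (x : ℕ) ≤ n := (le_max_right _ _).trans hn
    rw [outcome_pos_inGet (he.inp x hx)]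
    cases hbx : b x with
    | false => simpa using hskip h2 e he.tail
    | true =>
      rw [if_pos rfl]
      obtain ⟨o, ho⟩ := Option.isSome_iff_exists.1 he.out
      cases o with
      | true => simpa using hs.safe 0 hlen e he.tail ho
      | false =>
        rw [hs.disj hph' ?_ e he.tail ho]
        · rcases hc with h | h | h
          · rw [ho] at h; simp at h
          · simpa using ⟨_, h, hbx⟩
          · rw [hbx] at h; simp at h
        · intro k hk hk0
          have := hw.nonpos (hused h2) k hk
          omega
  constructor
  · intro p hp e he ho
    cases p with
    | succ p => exact hs.safe p (by simpa using hp) e he.tail ho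
    | zero =>
      rw [List.drop_zero]
      rcases Scan.kindOf_cases hk with h | h | h | h | h | h
      · rw [he.outcome_of_cls_one h.1]
        simpa using hs.safe 0 hlen _ (he.tail.update_out true) (by simp)
      · rw [he.outcome_of_cls_two h.1]
        exact hs.safe 1 (by have := hw.length_kinds; omega) _ (he.tail.update_out true) (by simp)
      · obtain ⟨e', he', h'⟩ := he.outcome_of_cls_three h.1 (hw.auxFree (hused h.2.1))
        rw [h', hskip h.2.1 e' he']
      · obtain ⟨x, rfl⟩ := eq_pos_of_cls h.1
        exact hin x rfl h.2.1 e he (Or.inl ho)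
      · obtain ⟨x, rfl⟩ := eq_pos_of_cls h.1
        exact hin x rfl h.2.1 e he (Or.inl ho)
      · obtain ⟨l, rfl⟩ := eq_jump_of_cls h.1
        obtain ⟨p, hp, hp', -⟩ := Scan.exists_of_kindAt_ne_zero (h.2.1 ▸ hk)
        rw [arg_jump] at hp
        subst hp
        rw [outcome_jump_succ]
        exact hs.safe p (hw.length_kinds ▸ hp') e he.tail ho
  · intro p hp e he
    cases p with
    | succ p => exact hs.favors p hp e he.tail
    | zero =>
      replace hp : Favors b (σ.kindOf I) := hp
      rw [List.drop_zero]
      rcases Scan.kindOf_cases hk with h | h | h | h | h | h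
      · rw [he.outcome_of_cls_one h.1]
        simpa using hs.safe 0 hlen _ (he.tail.update_out true) (by simp)
      · rw [he.outcome_of_cls_two h.1]
        exact hs.safe 1 (by have := hw.length_kinds; omega) _ (he.tail.update_out true) (by simp)
      · obtain ⟨e', he', h'⟩ := he.outcome_of_cls_three h.1 (hw.auxFree (hused h.2.1))
        rw [h', hskip h.2.1 e' he']
      · obtain ⟨x, rfl⟩ := eq_pos_of_cls h.1
        exact hin x rfl h.2.1 e he (Or.inr (Or.inl h.2.2.1))
      · obtain ⟨x, rfl⟩ := eq_pos_of_cls h.1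
        refine hin x rfl h.2.1 e he (Or.inr (Or.inr ?_))
        rw [h.2.2.2] at hp
        rcases hp with hp | hp
        · omega
        · simpa using hp.2
      · obtain ⟨l, rfl⟩ := eq_jump_of_cls h.1
        rw [h.2.1] at hp
        obtain ⟨p, hp1, -, hp2⟩ := Scan.exists_of_kindAt_ne_zero (h.2.1 ▸ hk)
        rw [arg_jump] at hp1
        subst hp1
        rw [outcome_jump_succ]
        exact hs.favors p (hp2 ▸ hp) e he.tail
  · simp
  · intro _ hr e he ho
    exact hs.disj hph' (fun k hk => hr k (List.mem_cons_of_mem _ hk)) e he.tail ho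

theorem Scan.Sound.test {n : ℕ} {b : ℕ → Bool} {X : List PInstr} {σ σ' : Scan} {I : PInstr}
    {x : ℕ+} {ph : Phase} (hs : σ.Sound n b X) (hw : σ.WF X)
    (hph : σ.phase = .pos ∧ ph = .opt ∧ I = .pos (.inGet x) ∨
      σ.phase = .opt ∧ ph = .act ∧ I = .neg (.inGet x))
    (hσ : σ.test x ph = some σ') (hn : σ'.mx ≤ n) : σ'.Sound n b (I :: X) := by
  obtain ⟨hk1, hk2, rfl⟩ := Scan.test_eq_some hσ
  have hx : (x : ℕ) ≤ n := (le_max_right _ _).trans hn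
  have hlen : 1 < X.length := by
    have := hw.length
    rcases hph with h | h <;> simp [Scan.excess, h.1] at this <;> omega
  -- The instruction sequences with which execution proceeds if `in:x` contains `1` and `0`.
  obtain ⟨d₁, d₀, hd₁, hd₀, hI, hcur, hrest⟩ : ∃ d₁ d₀, d₁ < X.length ∧ d₀ < X.length ∧
      (∀ e, Fits n b (I :: X) e → outcome (I :: X) e =
        if b x then outcome (X.drop d₁) e else outcome (X.drop d₀) e) ∧
      σ.kinds.getD d₁ 0 = σ.cur ∧ (σ.Resolved b → ∀ e, Fits n b X e → e .out = some false →
        outcome (X.drop d₀) e = some (decide (∃ x ∈ σ.seen, b x = true))) := by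
    rcases hph with ⟨h1, -, rfl⟩ | ⟨h1, -, rfl⟩
    · exact ⟨0, 1, by omega, hlen, fun e he => outcome_pos_inGet (he.inp x hx) X,
        hw.kinds_pos h1, hs.disj_tail h1⟩
    · exact ⟨1, 0, hlen, by omega, fun e he => outcome_neg_inGet (he.inp x hx) X,
        (hw.kinds_opt h1).2, hs.disj (Or.inr h1)⟩
  constructor
  · intro p hp e he ho
    cases p with
    | succ p => exact hs.safe p (by simpa using hp) e he.tail ho
    | zero =>
      rw [List.drop_zero, hI e he]
      split_ifs
      · exact hs.safe _ hd₁ e he.tail ho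
      · exact hs.safe _ hd₀ e he.tail ho
  · intro p hp e he
    cases p with
    | succ p => exact hs.favors p hp e he.tail
    | zero => simp [Favors] at hp
  · intro _ hr e he ho
    rw [hI e he]
    cases hbx : b x with
    | true =>
      rw [if_pos rfl, hs.favors d₁ _ e he.tail]
      · simp [hbx]
      · rw [hcur, Favors]
        have hph' : σ.phase = .pos ∨ σ.phase = .opt := by tauto
        have h0 := hw.cur_ne hph'
        rcases lt_or_gt_of_ne h0 with h | h
        · exact Or.inl h
        · refine Or.inr ⟨h, hr σ.cur (List.mem_cons_of_mem _ ?_) h ?_⟩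
          · rw [← hcur, List.getD_eq_getElem _ _ (by rw [hw.length_kinds]; exact hd₁)]
            exact List.getElem_mem _
          · intro hmem
            rcases Finset.mem_insert.1 hmem with h' | h'
            · exact hk2 (by rw [← h']; omega)
            · exact hw.cur_notMem hph' _ h' (by omega)
    | false =>
      rw [if_neg (by simp), hrest _ e he.tail ho]
      · simp [hbx]
      · intro k hk hk0 hks
        by_cases hkx : k.toNat = x
        · rw [hkx, hbx]
        · exact hr k (List.mem_cons_of_mem _ hk) hk0 (by simp [hks, hkx])
  · rcases hph with ⟨-, rfl, -⟩ | ⟨-, rfl, -⟩ <;> simp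

theorem Scan.mx_le_of_step {I : PInstr} {σ σ' : Scan} (h : σ.step I = some σ') :
    σ.mx ≤ σ'.mx := by
  have ha : ∀ u, σ.action I u = some σ' → σ.mx ≤ σ'.mx := by
    intro u h
    obtain ⟨-, rfl⟩ := Scan.action_eq_some h
    dsimp only
    split_ifs <;> omega
  have ht : ∀ ph, σ.test I.arg ph = some σ' → σ.mx ≤ σ'.mx := by
    intro ph h
    obtain ⟨-, -, rfl⟩ := Scan.test_eq_some h
    exact le_max_left _ _
  unfold Scan.step at h
  split at h
  · split_ifs at h
    rw [Option.some_inj] at h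
    subst h
    exact le_rfl
  · exact ha _ h
  · split_ifs at h
    exact ht _ h
  · split_ifs at h
    · exact ht _ h
    · exact ha _ h

theorem scan_sound {n : ℕ} {b : ℕ → Bool} {X : List PInstr} {σ : Scan} (h : scan X = some σ)
    (hn : σ.mx ≤ n) : σ.Sound n b X := by
  induction X generalizing σ with
  | nil =>
    simp only [scan, Option.some_inj] at h
    subst h
    constructor <;> simp [Favors]
  | cons I X ih =>
    rw [scan, Option.bind_eq_some_iff] at h
    obtain ⟨τ, hτ, h⟩ := h
    have hw := scan_wf hτ
    have hs := ih hτ ((Scan.mx_le_of_step h).trans hn)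
    unfold Scan.step at h
    split at h
    · rename_i hph
      split_ifs at h with hc
      rw [Option.some_inj] at h
      subst h
      obtain rfl := eq_halt_of_cls hc
      obtain ⟨rfl, hu⟩ := hw.term hph
      have hk : τ.kinds = [] := List.eq_nil_of_length_eq_zero hw.length_kinds
      have hs : τ.seen = ∅ := by
        have := hw.length
        simpa [Scan.excess, hph, hu] using this
      refine ⟨?_, ?_, ?_, by simp⟩
      · intro p hp e _ ho
        obtain rfl : p = 0 := by simpa using hp
        simpa using ho
      · intro p hp
        rw [hk] at hp
        rcases p with _ | p <;> simp [Favors] at hp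
      · intro _ _ e _ ho
        simp [hs, ho]
    · rename_i hph
      exact hs.action hw (Or.inl ⟨hph, rfl⟩) h hn
    · rename_i hph
      split_ifs at h with hc
      obtain ⟨x, rfl⟩ := eq_pos_of_cls hc
      exact hs.test hw (Or.inl ⟨hph, rfl, rfl⟩) h hn
    · rename_i hph
      split_ifs at h with hc hu
      · obtain ⟨x, rfl⟩ := eq_neg_of_cls hc
        exact hs.test hw (Or.inr ⟨hph, rfl, rfl⟩) h hn
      · exact hs.action hw (Or.inr ⟨hph, by simpa using hu, rfl⟩) h hn

theorem two_mul_length_tstnz' (n : ℕ) :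
    2 * (tstnz' n).length = if Even n then 3 * n + 2 else 3 * n + 3 := by
  unfold tstnz'
  split_ifs with h
  · simp; have := Nat.even_iff.1 h; omega
  · simp; have := Nat.not_even_iff.1 h; omega

theorem Scan.WF.card_seen {n : ℕ} {X : List PInstr} {σ : Scan} (hw : σ.WF X)
    (hph : σ.phase = .act ∨ σ.phase = .opt ∧ σ.used = false)
    (hl : X.length = (tstnz' n).length) : σ.seen.card = n := by
  have hlen := hw.length
  rw [hl, two_mul_length_tstnz'] at hlen
  have hexc : σ.excess = 2 ∨ σ.excess = 3 := by
    rcases hph with h | ⟨h, h'⟩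
    · cases hu : σ.used <;> simp [Scan.excess, h, hu]
    · simp [Scan.excess, h, h']
  split_ifs at hlen with he
  · have := Nat.even_iff.1 he
    omega
  · have := Nat.not_even_iff.1 he
    omega

theorem exists_aux_bound (X : List PInstr) : ∃ k : ℕ, ∀ e : Env,
    (∀ i : ℕ+, (i : ℕ) ≤ k → e (.aux i) = some false) → ∀ I ∈ X, I.AuxFits e := by
  have key : ∀ I : PInstr, ∃ k : ℕ, ∀ e : Env,
      (∀ i : ℕ+, (i : ℕ) ≤ k → e (.aux i) = some false) → I.AuxFits e := by
    intro I
    by_cases h : I.AuxFree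
    · exact ⟨0, fun e _ => h.auxFits e⟩
    · unfold PInstr.AuxFree at h
      split at h <;> try exact absurd trivial h
      all_goals first
        | rename_i i; exact ⟨(i : ℕ+), fun e he => by simp [PInstr.AuxFits, he i le_rfl]⟩
        | rename_i i _; exact ⟨(i : ℕ+), fun e he => by simp [PInstr.AuxFits, he i le_rfl]⟩
  induction X with
  | nil => exact ⟨0, by simp⟩
  | cons I X ih =>
    obtain ⟨k, hk⟩ := ih
    obtain ⟨l, hl⟩ := key I
    refine ⟨max k l, fun e he J hJ => ?_⟩
    rcases List.mem_cons.1 hJ with rfl | hJ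
    · exact hl e fun i hi => he i (hi.trans (le_max_right _ _))
    · exact hk e (fun i hi => he i (hi.trans (le_max_left _ _))) J hJ

theorem computes_iff {n : ℕ} {X : List PInstr} {f : (Fin n → Bool) → Bool} :
    Computes X f ↔ ∃ k, ∀ b, outcome X (initEnv n k b) = some (f b) := by
  unfold Computes outcome
  simp only [Option.bind_eq_some_iff]

theorem computes_of_accepts {n : ℕ} {X : List PInstr} {σ : Scan} (h : scan X = some σ)
    (ha : σ.Accepts) (hl : X.length = (tstnz' n).length) : Computes X (nzt n) := by
  have hw := scan_wf h
  obtain ⟨hph, hmx⟩ := ha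
  have hcard := hw.card_seen hph hl
  have hseen : σ.seen = Finset.Icc 1 n := by
    refine Finset.eq_of_subset_of_card_le (fun x hx => ?_) (by simp [hcard])
    exact Finset.mem_Icc.2 ⟨hw.seen_pos x hx, (hw.seen_le x hx).trans (hcard ▸ hmx)⟩
  obtain ⟨k, hk⟩ := exists_aux_bound X
  refine computes_iff.2 ⟨k, fun b => ?_⟩
  set c : ℕ → Bool := fun i => if h : 0 < i ∧ i ≤ n then b ⟨i - 1, by omega⟩ else false with hc
  have hfit : Fits n c X (initEnv n k b) := by
    refine ⟨fun i hi => ?_, rfl, hk _ fun i hi => by simp [initEnv, hi]⟩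
    simp [initEnv, hi, hc, i.pos]
  rw [(scan_sound h (hcard ▸ hmx)).disj (by tauto) ?_ _ hfit rfl, nzt, hseen]
  · congr 1
    rw [decide_eq_decide]
    constructor
    · rintro ⟨x, hx, hbx⟩
      rw [Finset.mem_Icc] at hx
      simp only [hc] at hbx
      rw [dif_pos ⟨by omega, hx.2⟩] at hbx
      exact ⟨_, hbx⟩
    · rintro ⟨i, hi⟩
      refine ⟨i + 1, Finset.mem_Icc.2 ⟨by omega, i.2⟩, ?_⟩
      simp only [hc]
      rw [dif_pos ⟨by omega, i.2⟩]
      simpa using hi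
  · intro k hk hk0 hks
    have := hw.kinds_le k hk
    rw [hseen, Finset.mem_Icc] at hks
    omega

/-! ### Correct instruction sequences are accepted -/

/-- What a scan guarantees about the positions where execution does not lead to `1` in `out`: at a
position of kind `0` if the inputs in `V` are `0`, and at a position of kind `x` if `in:x` contains
`1` and the other inputs in `V` are `0`. -/
structure Scan.Futile (X : List PInstr) (V : Finset ℕ+) (σ : Scan) : Prop where
  zero : ∀ (p : ℕ) (e : Env), σ.kinds.getD p 0 = 0 → e .out = some false →
    (∀ i ∈ V, e (.inp i) = some false) → outcome (X.drop p) e ≠ some true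
  pos : ∀ (p : ℕ) (e : Env) (x : ℕ+), σ.kinds.getD p 0 = x → e .out = some false →
    e (.inp x) = some true → (∀ i ∈ V, i ≠ x → e (.inp i) = some false) →
    outcome (X.drop p) e ≠ some true

/-- An instruction of class `0` or `7` has no effect that could change the outcome of what
follows. -/
theorem outcome_ne_true_of_cls_zero {T : PInstr} {X : List PInstr} {e : Env}
    (hT : T.cls = 0 ∨ T.cls = 7) (ho : e .out = some false) (haux : ∀ i, e (.aux i) ≠ some true)
    (hX : ∀ e' : Env, e' .out = some false → (∀ i, e' (.inp i) = e (.inp i)) →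
      outcome X e' ≠ some true) : outcome (T :: X) e ≠ some true := by
  have hset : ∀ (r : Reg) (b : Bool), (∀ i, r ≠ .inp i) → (r = .out → b = false) →
      outcome X (Function.update e r (some b)) ≠ some true := by
    intro r b hr hb
    refine hX _ ?_ fun i => by rw [Function.update_of_ne (hr i).symm]
    by_cases h : r = .out
    · subst h; simp [hb rfl]
    · rw [Function.update_of_ne (Ne.symm h), ho]
  have hself := hX e ho fun _ => rfl
  have hout : outcome X (Function.update e .out (some false)) ≠ some true :=
    hset .out false (by simp) (by simp)
  have hauxs : ∀ i b, outcome X (Function.update e (.aux i) (some b)) ≠ some true :=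
    fun i b => hset (.aux i) b (by simp) (by simp)
  rcases T with a | a | a | l | _
  · rcases a with i | (_ | _) | i | ⟨i, b⟩
    · rcases hi : e (.inp i) with _ | v <;>
        simp [outcome_plain, BInstr.perform, Env.get, hi, hself]
    · simp [outcome_plain, BInstr.perform, Env.set, ho, hout]
    · simp [PInstr.cls] at hT
    · rcases hi : e (.aux i) with _ | v <;>
        simp [outcome_plain, BInstr.perform, Env.get, hi, hself]
    · rcases hi : e (.aux i) with _ | v <;>
        simp [outcome_plain, BInstr.perform, Env.set, hi, hauxs]
  · rcases a with i | (_ | _) | i | ⟨i, (_ | _)⟩ <;> try simp [PInstr.cls] at hT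
    rcases hi : e (.aux i) with _ | v <;>
      simp [outcome_pos, BInstr.perform, Env.set, hi, hauxs]
  · rcases a with i | (_ | _) | i | ⟨i, (_ | _)⟩ <;> try simp [PInstr.cls] at hT
    · simp [outcome_neg, BInstr.perform, Env.set, ho, hout]
    · rcases hi : e (.aux i) with _ | (_ | _)
      · simp [outcome_neg, BInstr.perform, Env.get, hi]
      · simp [outcome_neg, BInstr.perform, Env.get, hi, hself]
      · exact absurd hi (haux i)
    · rcases hi : e (.aux i) with _ | v <;>
        simp [outcome_neg, BInstr.perform, Env.set, hi, hauxs]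
  · simp [PInstr.cls] at hT
  · simp [ho]

theorem outcome_ne_true_of_cls_three {T : PInstr} {X : List PInstr} {e : Env}
    (hT : T.cls = 3) (ho : e .out = some false) (haux : ∀ i, e (.aux i) ≠ some true)
    (hX : ∀ e' : Env, e' .out = some false → (∀ i, e' (.inp i) = e (.inp i)) →
      outcome (X.drop 1) e' ≠ some true) : outcome (T :: X) e ≠ some true := by
  have hself := hX e ho fun _ => rfl
  have hout : outcome (X.drop 1) (Function.update e .out (some false)) ≠ some true :=
    hX _ (by simp) (by simp)
  have hauxs : ∀ i b, outcome (X.drop 1) (Function.update e (.aux i) (some b)) ≠ some true :=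
    fun i b => hX _ (by simp [ho]) (by simp)
  rw [List.drop_one] at *
  rcases T with a | a | a | l | _
  · rcases a with i | (_ | _) | i | ⟨i, b⟩ <;> simp [PInstr.cls] at hT
  · rcases a with i | (_ | _) | i | ⟨i, (_ | _)⟩ <;> try simp [PInstr.cls] at hT
    · simp [outcome_pos, BInstr.perform, Env.set, ho, hout]
    · rcases hi : e (.aux i) with _ | (_ | _)
      · simp [outcome_pos, BInstr.perform, Env.get, hi]
      · simp [outcome_pos, BInstr.perform, Env.get, hi, hself]
      · exact absurd hi (haux i)
    · rcases hi : e (.aux i) with _ | v <;>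
        simp [outcome_pos, BInstr.perform, Env.set, hi, hauxs]
  · rcases a with i | (_ | _) | i | ⟨i, (_ | _)⟩ <;> try simp [PInstr.cls] at hT
    rcases hi : e (.aux i) with _ | v <;>
      simp [outcome_neg, BInstr.perform, Env.set, hi, hauxs]
  · simp [PInstr.cls] at hT
  · simp [PInstr.cls] at hT

theorem cls_le_seven (I : PInstr) : I.cls ≤ 7 := by
  unfold PInstr.cls; split <;> omega

theorem exists_pnat_of_pos {k : ℤ} (h : 0 < k) : ∃ x : ℕ+, k = (x : ℕ) :=
  ⟨⟨k.toNat, by omega⟩, by simp; omega⟩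

/-- If changing any of the inputs in `A` makes execution proceed with `T`, and makes the outcome
`1`, also together with one more input tested in `X`, then `T` is useful. -/
theorem Scan.kindOf_ne_zero {U V A : Finset ℕ+} {s : ℕ} {e : Env} {T : PInstr} {X : List PInstr}
    {σ : Scan} (hz : ZeroOn U e) (ho : e .out = some false)
    (haux : ∀ i, e (.aux i) ≠ some true) (hV : V ⊆ U) (hX : Shape X V s) (hw : σ.WF X)
    (hf : σ.Futile X V) (hseen : ∀ x : ℕ+, (x : ℕ) ∈ σ.seen ↔ x ∈ V)
    (hph : σ.phase = .act ∨ σ.phase = .opt ∧ σ.used = false)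
    (hA : A.Nonempty) (hAV : ∀ a ∈ A, a ∉ V)
    (hout : ∀ a ∈ A, ∀ x ∈ insert a V, outcome (T :: X) (flip (flip e a) x) = some true)
    (hopt : σ.phase = .opt → ∀ x, ∃ a ∈ A, a ≠ x) :
    σ.kindOf T ≠ 0 ∧ (T.cls = 4 → ∃ x ∈ U, T = .pos (.inGet x)) := by
  have hflip : ∀ a, flip (flip e a) a = flip e a := fun a => by simp [flip]
  have hout1 : ∀ a ∈ A, outcome (T :: X) (flip e a) = some true := fun a ha => by
    rw [← hflip]; exact hout a ha a (by simp)
  have hVz : ∀ a ∈ A, ∀ i ∈ V, flip e a (.inp i) = some false := fun a ha i hi => by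
    rw [flip_of_ne _ (by rintro rfl; exact hAV i ha hi), hz i, if_pos (hV hi)]
  have hstart : ∀ a ∈ A, ∀ e' : Env, e' .out = some false →
      (∀ i, e' (.inp i) = flip e a (.inp i)) → outcome X e' ≠ some true := by
    intro a ha e' ho' hi'
    rw [hX.outcome_eq fun i hi => (hi' i).trans (hVz a ha i hi), ho']
    simp
  have hskip : σ.kindAt 2 = 0 → ∀ a ∈ A, ∀ e' : Env, e' .out = some false →
      (∀ i, e' (.inp i) = flip e a (.inp i)) → outcome (X.drop 1) e' ≠ some true :=
    fun h2 a ha e' ho' hi' => hf.zero 1 e' h2 ho' fun i hi => (hi' i).trans (hVz a ha i hi)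
  have hneg : σ.kindAt 2 ≠ 0 → σ.kindAt 2 < 0 := by
    intro h2
    rcases hph with h | ⟨-, h⟩
    · exact absurd (hw.kinds_act h) h2
    · have := (Scan.kindAt_le hw 2).2 h
      omega
  obtain ⟨a, ha⟩ := hA
  have hofa : flip e a .out = some false := by simp [ho]
  have hauxa : ∀ i, flip e a (.aux i) ≠ some true := fun i => by simpa using haux i
  have hinp : ∀ c x, c ≠ x → flip e c (.inp x) = if x ∈ U then some false else none :=
    fun c x h => by rw [flip_of_ne _ h.symm, hz x]
  have h7 := cls_le_seven T
  obtain h | h | h | h | h | h | h | h : T.cls = 0 ∨ T.cls = 1 ∨ T.cls = 2 ∨ T.cls = 3 ∨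
    T.cls = 4 ∨ T.cls = 5 ∨ T.cls = 6 ∨ T.cls = 7 := by omega
  · exact absurd (hout1 a ha)
      (outcome_ne_true_of_cls_zero (Or.inl h) hofa hauxa (hstart a ha))
  · simp [kindOf, h]
  · refine ⟨?_, by omega⟩
    by_cases hl : 2 ≤ σ.kinds.length
    · simp [kindOf, h, hl]
    · exfalso
      rw [hw.length_kinds] at hl
      have := hout1 a ha
      have hd : X.drop 1 = [] := List.drop_eq_nil_of_le (by omega)
      unfold PInstr.cls at h
      split at h <;> simp_all [outcome_neg, BInstr.perform, Env.set]
  · refine ⟨?_, by omega⟩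
    by_cases h2 : σ.kindAt 2 = 0
    · exact absurd (hout1 a ha) (outcome_ne_true_of_cls_three h hofa hauxa (hskip h2 a ha))
    · simp [kindOf, h, hneg h2]
  · obtain ⟨x, rfl⟩ := eq_pos_of_cls h
    have hxa : a ≠ x := by
      rintro rfl
      have := hout1 a ha
      rw [outcome_pos_inGet (flip_self e a), if_pos rfl] at this
      exact hstart a ha _ hofa (fun _ => rfl) this
    have hxU : x ∈ U := by
      by_contra hxU
      obtain ⟨v, hv⟩ := exists_input (Or.inl (hout1 a ha))
      rw [hinp a x hxa, if_neg hxU] at hv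
      simp at hv
    have h2 : σ.kindAt 2 < 0 := by
      refine hneg fun h2 => ?_
      have := hout1 a ha
      rw [outcome_pos_inGet ((hinp a x hxa).trans (if_pos hxU)), if_neg (by simp)] at this
      exact hskip h2 a ha _ hofa (fun _ => rfl) this
    refine ⟨?_, fun _ => ⟨x, hxU, rfl⟩⟩
    unfold kindOf
    rw [h, if_pos h2]
    split_ifs <;> simp
  · refine ⟨?_, by omega⟩
    obtain ⟨l, rfl⟩ := eq_jump_of_cls h
    have hl : σ.kindAt l ≠ 0 := by
      intro hl
      have := hout1 a ha
      cases l with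
      | zero => simp at this
      | succ l =>
        rw [outcome_jump_succ] at this
        exact hf.zero l _ hl hofa (hVz a ha) this
    obtain ⟨p, rfl, -, hp⟩ := Scan.exists_of_kindAt_ne_zero hl
    rw [show σ.kindOf (.jump (p + 1)) = if 0 < σ.kindAt (p + 1) ∧
      (σ.kindAt (p + 1)).toNat ∈ σ.seen then 0 else σ.kindAt (p + 1) from rfl, if_neg]
    · exact hl
    · rintro ⟨h0, hmem⟩
      obtain ⟨x, hx⟩ := exists_pnat_of_pos h0
      rw [hx, Int.toNat_natCast, hseen] at hmem
      have := hout a ha x (by simp [hmem])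
      rw [outcome_jump_succ] at this
      refine hf.pos p _ x (hp.trans hx) (by simp [ho]) (flip_self _ _) (fun i hi hix => ?_) this
      rw [flip_of_ne _ hix]
      exact hVz a ha i hi
  · obtain ⟨x, rfl⟩ := eq_neg_of_cls h
    have hnext : ∀ c ∈ A, flip e c (.inp x) ≠ some false := by
      intro c hc hcx
      have := hout1 c hc
      rw [outcome_neg_inGet hcx, if_neg (by simp)] at this
      exact hstart c hc _ (by simp [ho]) (fun _ => rfl) this
    have hxa : ∀ c ∈ A, c = x := by
      intro c hc
      by_contra hcx
      obtain ⟨v, hv⟩ := exists_input (Or.inr (hout1 c hc))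
      have h1 := hinp c x hcx
      rw [hv] at h1
      split_ifs at h1
      exact hnext c hc (hv.trans h1)
    exfalso
    rcases hph with hph | ⟨hph, -⟩
    · have := hout1 a ha
      rw [← hxa a ha, outcome_neg_inGet (flip_self e a), if_pos rfl] at this
      exact hskip (hw.kinds_act hph) a ha _ hofa (fun _ => rfl) this
    · obtain ⟨c, hc, hcx⟩ := hopt hph x
      exact hcx (hxa c hc)
  · exact absurd (hout1 a ha)
      (outcome_ne_true_of_cls_zero (Or.inr h) hofa hauxa (hstart a ha))

theorem Scan.Futile.action {V : Finset ℕ+} {s : ℕ} {X : List PInstr} {σ σ' : Scan} {T : PInstr}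
    {u : Bool} (hX : Shape X V s) (hf : σ.Futile X V)
    (hseen : ∀ x : ℕ+, (x : ℕ) ∈ σ.seen ↔ x ∈ V) (hσ : σ.action T u = some σ') :
    σ'.Futile (T :: X) V := by
  obtain ⟨hk, rfl⟩ := Scan.action_eq_some hσ
  constructor
  · intro p e hp
    cases p with
    | zero => exact absurd hp hk
    | succ p => exact hf.zero p e hp
  · intro p e x hp ho hx hV
    cases p with
    | succ p => exact hf.pos p e x hp ho hx hV
    | zero =>
      replace hp : σ.kindOf T = x := hp
      rw [List.drop_zero]
      have := x.pos
      rcases Scan.kindOf_cases hk with h | h | h | h | ⟨h, -, h1, h2⟩ | ⟨h, h1, h2⟩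
      · omega
      · omega
      · omega
      · omega
      · obtain ⟨y, rfl⟩ := eq_pos_of_cls h
        rw [arg_pos_inGet] at h1 h2
        obtain rfl : y = x := PNat.eq (by omega)
        rw [hseen] at h1
        rw [outcome_pos_inGet hx, if_pos rfl, hX.outcome_eq, ho]
        · simp
        · intro i hi
          exact hV i hi (by rintro rfl; exact h1 hi)
      · obtain ⟨l, rfl⟩ := eq_jump_of_cls h
        rw [hp, arg_jump] at h1
        obtain ⟨p, rfl, -, hp'⟩ := Scan.exists_of_kindAt_ne_zero (σ := σ) (d := l) (by omega)
        rw [outcome_jump_succ]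
        exact hf.pos p e x (hp'.trans h1.symm) ho hx hV

theorem Scan.Futile.test {V : Finset ℕ+} {s : ℕ} {X : List PInstr} {σ σ' : Scan} {I : PInstr}
    {x : ℕ+} {ph : Phase} (hX : Shape (I :: X) (insert x V) s) (hf : σ.Futile X V)
    (hσ : σ.test x ph = some σ') : σ'.Futile (I :: X) (insert x V) := by
  obtain ⟨-, -, rfl⟩ := Scan.test_eq_some hσ
  constructor
  · intro p e hp ho hV
    cases p with
    | zero => rw [List.drop_zero, hX.outcome_eq hV, ho]; simp
    | succ p => exact hf.zero p e hp ho fun i hi => hV i (by simp [hi])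
  · intro p e y hp ho hy hV
    cases p with
    | zero =>
      have := y.pos
      have : (0 : ℤ) = (y : ℕ) := hp
      omega
    | succ p => exact hf.pos p e y hp ho hy fun i hi => hV i (by simp [hi])

theorem Scan.seen_test {V : Finset ℕ+} {σ σ' : Scan} {x : ℕ+} {ph : Phase}
    (hseen : ∀ y : ℕ+, (y : ℕ) ∈ σ.seen ↔ y ∈ V) (hσ : σ.test x ph = some σ') :
    ∀ y : ℕ+, (y : ℕ) ∈ σ'.seen ↔ y ∈ insert x V := by
  obtain ⟨-, -, rfl⟩ := Scan.test_eq_some hσ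
  intro y
  simp [hseen]

theorem Scan.exists_action {σ : Scan} {T : PInstr} (u : Bool) (h : σ.kindOf T ≠ 0) :
    ∃ σ', σ.action T u = some σ' := by
  simp [Scan.action, h]

/-- The test of an input that makes execution proceed with the last instruction of its block can be
read. -/
theorem Scan.Futile.exists_test {V : Finset ℕ+} {X : List PInstr} {σ : Scan} {x : ℕ+} {p : ℕ}
    {e : Env} (ph : Phase) (hf : σ.Futile X V) (hseen : ∀ y : ℕ+, (y : ℕ) ∈ σ.seen ↔ y ∈ V)
    (hxV : x ∉ V) (hcur : σ.kinds.getD p 0 = σ.cur) (ho : e .out = some false)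
    (hV : ∀ i ∈ V, e (.inp i) = some false) (hout : outcome (X.drop p) (flip e x) = some true) :
    ∃ σ', σ.test x ph = some σ' := by
  have h1 : (x : ℕ) ∉ σ.seen := by rwa [hseen]
  have h2 : σ.cur ≠ x := by
    intro h
    refine hf.pos p _ x (hcur.trans h) (by simp [ho]) (flip_self e x) (fun i hi hix => ?_) hout
    rw [flip_of_ne _ hix, hV i hi]
  simp [Scan.test, h1, h2]

theorem scan_cons_action {X : List PInstr} {σ σ' : Scan} {T : PInstr} (hX : scan X = some σ)
    (hph : σ.phase = .act ∨ σ.phase = .opt ∧ σ.used = false) (hT : T.cls ≠ 6)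
    (hσ : σ.action T (if σ.phase = .act then σ.used else true) = some σ') :
    scan (T :: X) = some σ' := by
  rw [scan, hX, Option.bind_some, Scan.step]
  rcases hph with h | ⟨h, h'⟩
  · simpa [h] using hσ
  · simpa [h, h', hT] using hσ

theorem scan_cons_pos {X : List PInstr} {σ σ' : Scan} {x : ℕ+} (hX : scan X = some σ)
    (hph : σ.phase = .pos) (hσ : σ.test x .opt = some σ') :
    scan (.pos (.inGet x) :: X) = some σ' := by
  rw [scan, hX, Option.bind_some, Scan.step, hph]
  simpa [PInstr.cls] using hσ

theorem scan_cons_neg {X : List PInstr} {σ σ' : Scan} {x : ℕ+} (hX : scan X = some σ)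
    (hph : σ.phase = .opt) (hσ : σ.test x .act = some σ') :
    scan (.neg (.inGet x) :: X) = some σ' := by
  rw [scan, hX, Option.bind_some, Scan.step, hph]
  simpa [PInstr.cls] using hσ

/-- The last two instructions of a block can be read. -/
theorem exists_scan_single {N s : ℕ} {U V A : Finset ℕ+} {e : Env} (hz : ZeroOn U e)
    (ho : e .out = some false) (haux : ∀ i, e (.aux i) ≠ some true) (hN : ∀ i ∈ U, (i : ℕ) ≤ N)
    {X : List PInstr} (hX : Shape X V s) (hV : V ⊆ U) {σ : Scan} (hσ : scan X = some σ)
    (hf : σ.Futile X V) (hseen : ∀ x : ℕ+, (x : ℕ) ∈ σ.seen ↔ x ∈ V) (hmx : σ.mx ≤ N)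
    (hph : σ.phase = .act ∨ σ.phase = .opt ∧ σ.used = false) {T : PInstr} {b : ℕ+}
    (hb : b ∈ A) (hbU : b ∈ U) (hAV : ∀ a ∈ A, a ∉ V)
    (hout : ∀ a ∈ A, ∀ x ∈ insert a V, outcome (T :: X) (flip (flip e a) x) = some true)
    (hopt : σ.phase = .opt → ∀ x, ∃ a ∈ A, a ≠ x) :
    ∃ τ, scan (.pos (.inGet b) :: T :: X) = some τ ∧
      τ.Futile (.pos (.inGet b) :: T :: X) (insert b V) ∧
      (∀ x : ℕ+, (x : ℕ) ∈ τ.seen ↔ x ∈ insert b V) ∧ τ.mx ≤ N ∧ τ.phase = .opt ∧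
      τ.used = if σ.phase = .act then σ.used else true := by
  have hw := scan_wf hσ
  obtain ⟨hk, h4⟩ := Scan.kindOf_ne_zero hz ho haux hV hX hw hf hseen hph ⟨b, hb⟩ hAV hout hopt
  obtain ⟨σ₁, h₁⟩ := Scan.exists_action (if σ.phase = .act then σ.used else true) hk
  have h6 : T.cls ≠ 6 := fun h => hk (by simp [Scan.kindOf, h])
  have hs₁ := scan_cons_action hσ hph h6 h₁
  have hf₁ := hf.action hX hseen h₁
  obtain ⟨-, e₁⟩ := Scan.action_eq_some h₁
  have hp₁ : σ₁.phase = .pos := by rw [e₁]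
  have hseen₁ : ∀ x : ℕ+, (x : ℕ) ∈ σ₁.seen ↔ x ∈ V := by rw [e₁]; exact hseen
  obtain ⟨σ₂, h₂⟩ := hf₁.exists_test (e := e) (x := b) .opt hseen₁ (hAV b hb)
    ((scan_wf hs₁).kinds_pos hp₁) ho (fun i hi => by rw [hz i, if_pos (hV hi)]) (by
      have := hout b hb b (by simp)
      simpa [flip] using this)
  refine ⟨σ₂, scan_cons_pos hs₁ hp₁ h₂, hf₁.test (.single b T hX (hAV b hb)) h₂,
    Scan.seen_test hseen₁ h₂, ?_⟩
  obtain ⟨-, -, e₂⟩ := Scan.test_eq_some h₂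
  refine ⟨?_, by rw [e₂], by rw [e₂, e₁]⟩
  rw [e₂, e₁]
  refine max_le ?_ (hN b hbU)
  dsimp only
  split_ifs with hc
  · obtain ⟨x, hxU, rfl⟩ := h4 hc
    exact max_le hmx (hN x hxU)
  · exact hmx

/-- An instruction sequence of the right shape is read without failure if the outcome is `1`
whenever one or two of the inputs tested by the blocks are `1`. -/
theorem exists_scan_of_shape {N : ℕ} {U : Finset ℕ+} {e : Env} (hz : ZeroOn U e)
    (ho : e .out = some false) (haux : ∀ i, e (.aux i) ≠ some true) (hN : ∀ i ∈ U, (i : ℕ) ≤ N)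
    {X : List PInstr} {V : Finset ℕ+} {s : ℕ} (h : Shape X V s) (hV : V ⊆ U) (hs : s ≤ 1)
    (hout : ∀ i ∈ V, ∀ x ∈ V, outcome X (flip (flip e i) x) = some true) :
    ∃ σ, scan X = some σ ∧ σ.Futile X V ∧ (∀ x : ℕ+, (x : ℕ) ∈ σ.seen ↔ x ∈ V) ∧ σ.mx ≤ N ∧
      (σ.phase = .act ∧ (σ.used = true → s = 1) ∨
        σ.phase = .opt ∧ σ.used = false ∧ s = 1) := by
  induction h with
  | halt =>
    refine ⟨⟨.act, false, 0, [0], ∅, 0⟩, rfl, ⟨?_, ?_⟩, by simp, by simp, by simp⟩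
    · intro p e' _ ho' _
      rcases p with _ | p <;> simp [ho']
    · intro p e' _ _ ho' _ _
      rcases p with _ | p <;> simp [ho']
  | @pair X V s a b T hX hb ha ih =>
    have haU : a ∈ U := hV (by simp)
    have hbU : b ∈ U := hV (by simp)
    have hVU : V ⊆ U := fun i hi => hV (by simp [hi])
    simp only [Finset.mem_insert, not_or] at ha
    have hz' : ∀ i x c, c ∈ U → c ≠ i → c ≠ x → flip (flip e i) x (.inp c) = some false :=
      fun i x c hc h1 h2 => by rw [flip_of_ne _ h2, flip_of_ne _ h1, hz c, if_pos hc]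
    have hne : ∀ i ∈ V, a ≠ i ∧ b ≠ i := fun i hi =>
      ⟨by rintro rfl; exact ha.2 hi, by rintro rfl; exact hb hi⟩
    obtain ⟨σ, hσ, hf, hseen, hmx, hph⟩ := ih hVU hs fun i hi x hx => by
      have := hout i (by simp [hi]) x (by simp [hx])
      rwa [outcome_neg_inGet (hz' i x a haU (hne i hi).1 (hne x hx).1), if_neg (by simp),
        outcome_pos_cons_of_false (hz' i x b hbU (hne i hi).2 (hne x hx).2)] at this
    have hph' : σ.phase = .act ∨ σ.phase = .opt ∧ σ.used = false := by tauto
    have hT : ∀ c ∈ ({a, b} : Finset ℕ+), ∀ x ∈ insert c V,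
        outcome (T :: X) (flip (flip e c) x) = some true := by
      intro c hc x hx
      have hta : ∀ y, flip (flip e y) x (.inp y) = some true := fun y => by
        by_cases hxy : y = x
        · subst hxy; simp
        · rw [flip_of_ne _ hxy, flip_self]
      have hxV : x ∈ insert a (insert b V) := by
        simp only [Finset.mem_insert, Finset.mem_singleton] at hc hx ⊢
        rcases hx with rfl | hx <;> tauto
      have := hout c (by simp at hc ⊢; tauto) x hxV
      simp only [Finset.mem_insert, Finset.mem_singleton] at hc
      rcases hc with rfl | rfl
      · rwa [outcome_neg_inGet (hta c), if_pos rfl, List.drop_succ_cons, List.drop_zero] at this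
      · have hax : a ≠ x := by
          rcases Finset.mem_insert.1 hx with rfl | hx
          · exact ha.1
          · exact (hne x hx).1
        rwa [outcome_neg_inGet (hz' c x a haU ha.1 hax), if_neg (by simp),
          outcome_pos_inGet (hta c), if_pos rfl] at this
    obtain ⟨σ₂, hs₂, hf₂, hseen₂, hmx₂, hp₂, hu₂⟩ := exists_scan_single (A := {a, b}) (b := b) hz
      ho haux hN hX hVU hσ hf hseen hmx hph' (by simp) hbU (by simp; tauto) hT
      (fun _ x => by
        by_cases hax : a = x
        · exact ⟨b, by simp, by rintro rfl; exact ha.1 hax⟩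
        · exact ⟨a, by simp, hax⟩)
    obtain ⟨σ₃, h₃⟩ := hf₂.exists_test (e := e) (x := a) .act hseen₂ (by simp [ha])
      ((scan_wf hs₂).kinds_opt hp₂).2 ho
      (fun i hi => by rw [hz i, if_pos (hV (Finset.mem_insert_of_mem hi))]) (by
        have := hT a (by simp) a (by simp)
        simpa [flip] using this)
    refine ⟨σ₃, scan_cons_neg hs₂ hp₂ h₃,
      hf₂.test (.pair a b T hX hb (by simp [ha])) h₃, Scan.seen_test hseen₂ h₃, ?_⟩
    obtain ⟨-, -, e₃⟩ := Scan.test_eq_some h₃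
    rw [e₃]
    refine ⟨max_le hmx₂ (hN a haU), Or.inl ⟨rfl, ?_⟩⟩
    dsimp only
    rw [hu₂]
    rcases hph with ⟨h1, h2⟩ | ⟨h1, h2, h3⟩
    · simpa [h1] using h2
    · exact fun _ => h3
  | @single X V s a T hX ha ih =>
    have haU : a ∈ U := hV (by simp)
    have hVU : V ⊆ U := fun i hi => hV (by simp [hi])
    obtain rfl : s = 0 := by omega
    have hz' : ∀ i x, a ≠ i → a ≠ x → flip (flip e i) x (.inp a) = some false :=
      fun i x h1 h2 => by rw [flip_of_ne _ h2, flip_of_ne _ h1, hz a, if_pos haU]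
    have hne : ∀ i ∈ V, a ≠ i := fun i hi => by rintro rfl; exact ha hi
    obtain ⟨σ, hσ, hf, hseen, hmx, hph⟩ := ih hVU (by omega) fun i hi x hx => by
      have := hout i (by simp [hi]) x (by simp [hx])
      rwa [outcome_pos_cons_of_false (hz' i x (hne i hi) (hne x hx))] at this
    have hph' : σ.phase = .act := by
      rcases hph with h | h
      · exact h.1
      · exact absurd h.2.2 (by simp)
    have hu : σ.used = false := by
      rcases hph with h | h
      · simpa using h.2
      · exact h.2.1
    obtain ⟨σ₂, hs₂, hf₂, hseen₂, hmx₂, hp₂, hu₂⟩ := exists_scan_single (A := {a}) (b := a) hz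
      ho haux hN hX hVU hσ hf hseen hmx (Or.inl hph') (by simp) haU (by simp [ha])
      (T := T) (by
        intro c hc x hx
        obtain rfl : c = a := by simpa using hc
        have := hout c (by simp) x (by simpa using hx)
        have hta : flip (flip e c) x (.inp c) = some true := by
          by_cases hxy : c = x
          · subst hxy; simp
          · rw [flip_of_ne _ hxy, flip_self]
        rwa [outcome_pos_inGet hta, if_pos rfl] at this)
      (by simp [hph'])
    refine ⟨σ₂, hs₂, hf₂, hseen₂, hmx₂, Or.inr ⟨hp₂, ?_, rfl⟩⟩
    rw [hu₂, if_pos hph', hu]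

theorem accepts_of_computes {n : ℕ} (hn : 1 ≤ n) {X : List PInstr} (h : Computes X (nzt n))
    (hl : X.length = (tstnz' n).length) : ∃ σ, scan X = some σ ∧ σ.Accepts := by
  obtain ⟨k, hk⟩ := computes_iff.1 h
  obtain ⟨m, rfl⟩ : ∃ m : ℕ+, n = m := ⟨⟨n, hn⟩, rfl⟩
  set n : ℕ := (m : ℕ) with hnm
  set U : Finset ℕ+ := Finset.Icc 1 m with hU
  have hmem : ∀ i : ℕ+, i ∈ U ↔ (i : ℕ) ≤ n := by
    intro i
    rw [hU, Finset.mem_Icc, ← PNat.coe_le_coe, ← PNat.coe_le_coe]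
    simp [hnm, Nat.succ_le_iff]
  have hcard : U.card = n := by rw [hU, PNat.card_Icc]; simp [hnm]
  set e := initEnv n k fun _ => false with he
  have hz : ZeroOn U e := by
    intro i
    by_cases hi : (i : ℕ) ≤ n <;> simp [he, initEnv, hmem, hi]
  have ho : e .out = some false := rfl
  have haux : ∀ i, e (.aux i) ≠ some true := by
    intro i
    by_cases hi : (i : ℕ) ≤ k <;> simp [he, initEnv, hi]
  have hflip : ∀ i ∈ U, ∀ x ∈ U, flip (flip e i) x =
      initEnv n k fun j => decide ((j : ℕ) + 1 = i ∨ (j : ℕ) + 1 = x) := by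
    intro i hi x hx
    rw [hmem] at hi hx
    funext r
    cases r with
    | inp j =>
      by_cases hj : (j : ℕ) ≤ n
      · have h1 : (j : ℕ) - 1 + 1 = j := Nat.sub_add_cancel j.pos
        by_cases hjx : j = x
        · subst hjx
          simp [initEnv, hj, h1]
        · rw [flip_of_ne _ hjx]
          by_cases hji : j = i
          · subst hji
            simp [initEnv, hj, h1]
          · rw [flip_of_ne _ hji]
            simp [he, initEnv, hj, h1, hjx, hji]
      · rw [flip_of_ne _ (by rintro rfl; exact hj hx), flip_of_ne _ (by rintro rfl; exact hj hi)]
        simp [he, initEnv, hj]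
    | out => simp [he, initEnv]
    | aux j => simp [he, initEnv]
  have hout : ∀ i ∈ U, ∀ x ∈ U, outcome X (flip (flip e i) x) = some true := by
    intro i hi x hx
    rw [hflip i hi x hx, hk, nzt, Option.some_inj, decide_eq_true_iff]
    rw [hmem] at hi
    have := i.pos
    exact ⟨⟨i - 1, by omega⟩, by simp; omega⟩
  have h0 : outcome X e = some false := by rw [hk]; simp [nzt]
  have hsens : sens U X e = U := by
    ext i
    rw [mem_sens]
    refine ⟨fun h => h.1, fun h => ⟨h, ?_⟩⟩
    have := hout i h i h
    simpa [flip] using this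
  have hlen := two_mul_length_tstnz' n
  obtain ⟨s, hs, hshape⟩ : ∃ s ≤ 1, Shape X U s := by
    split_ifs at hlen
    · exact ⟨0, by omega, hsens ▸ shape_zero_of_length hz h0 (by rw [hsens, hcard]; omega)⟩
    · exact ⟨1, le_rfl, hsens ▸ shape_one_of_length hz ho h0 (by rw [hsens, hcard]; omega)⟩
  obtain ⟨σ, hσ, -, -, hmx, hph⟩ := exists_scan_of_shape (N := n) hz ho haux
    (fun i hi => (hmem i).1 hi) hshape subset_rfl hs hout
  have hph' : σ.phase = .act ∨ σ.phase = .opt ∧ σ.used = false := by tauto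
  exact ⟨σ, hσ, hph', by rwa [(scan_wf hσ).card_seen hph' hl]⟩

/-- The combinatorial criterion: `scan` decides correctness among the instruction sequences of the
length of `TSTNZ'_n`. -/
theorem computes_iff_accepts {n : ℕ} (hn : 1 ≤ n) {X : List PInstr}
    (hl : X.length = (tstnz' n).length) :
    Computes X (nzt n) ↔ ∃ σ, scan X = some σ ∧ σ.Accepts :=
  ⟨fun h => accepts_of_computes hn h hl, fun ⟨_, h, ha⟩ => computes_of_accepts h ha hl⟩

end InSeq

/-! ### Execution of RAM programs -/

namespace RAM

/-- From the configuration `c`, a configuration with the property `Q` is reached in at most `N`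
steps. -/
def Leads (P : List Instr) (N : ℕ) (c : Config) (Q : Config → Prop) : Prop :=
  ∃ t ≤ N, ∃ d, stepN P t c = some d ∧ Q d

theorem stepN_add (P : List Instr) (s t : ℕ) (c : Config) :
    stepN P (s + t) c = (stepN P s c).bind (stepN P t) := by
  induction s generalizing c with
  | zero => simp [stepN]
  | succ s ih =>
    rw [Nat.succ_add, stepN, stepN, Option.bind_assoc]
    congr 1
    funext d
    exact ih d

variable {P : List Instr} {N M pc : ℕ} {m : ℕ → ℤ} {inp outp : List ℤ} {Q R : Config → Prop}

theorem Leads.done {c : Config} (h : Q c) : Leads P N c Q := ⟨0, Nat.zero_le _, c, rfl, h⟩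

theorem Leads.trans {c : Config} (h : Leads P N c Q) (h' : ∀ d, Q d → Leads P M d R) :
    Leads P (N + M) c R := by
  obtain ⟨s, hs, d, hd, hQ⟩ := h
  obtain ⟨t, ht, d', hd', hR⟩ := h' d hQ
  exact ⟨s + t, Nat.add_le_add hs ht, d', by rw [stepN_add, hd]; exact hd', hR⟩

theorem Leads.mono {c : Config} (h : Leads P N c Q) (hN : N ≤ M) : Leads P M c Q := by
  obtain ⟨s, hs, h⟩ := h
  exact ⟨s, hs.trans hN, h⟩

theorem Leads.step {c d : Config} (h : step P c = some d) (h' : Leads P N d Q) :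
    Leads P (N + 1) c Q := by
  obtain ⟨t, ht, d', hd', hQ⟩ := h'
  exact ⟨t + 1, Nat.succ_le_succ ht, d', by rw [stepN, h]; exact hd', hQ⟩

theorem Leads.const {i : ℕ} {v : ℤ} (h : P[pc]? = some (.const i v))
    (h' : Leads P N ⟨pc + 1, Function.update m i v, inp, outp⟩ Q) :
    Leads P (N + 1) ⟨pc, m, inp, outp⟩ Q :=
  .step (by simp [RAM.step, h, Config.assign]) h'

theorem Leads.add {i j k : ℕ} (h : P[pc]? = some (.add i j k))
    (h' : Leads P N ⟨pc + 1, Function.update m i (m j + m k), inp, outp⟩ Q) :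
    Leads P (N + 1) ⟨pc, m, inp, outp⟩ Q :=
  .step (by simp [RAM.step, h, Config.assign]) h'

theorem Leads.sub {i j k : ℕ} (h : P[pc]? = some (.sub i j k))
    (h' : Leads P N ⟨pc + 1, Function.update m i (m j - m k), inp, outp⟩ Q) :
    Leads P (N + 1) ⟨pc, m, inp, outp⟩ Q :=
  .step (by simp [RAM.step, h, Config.assign]) h'

theorem Leads.load {i j a : ℕ} (h : P[pc]? = some (.load i j)) (hj : m j = a)
    (h' : Leads P N ⟨pc + 1, Function.update m i (m a), inp, outp⟩ Q) :
    Leads P (N + 1) ⟨pc, m, inp, outp⟩ Q :=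
  .step (by simp [RAM.step, h, Config.assign, hj]) h'

theorem Leads.store {i j a : ℕ} (h : P[pc]? = some (.store i j)) (hi : m i = a)
    (h' : Leads P N ⟨pc + 1, Function.update m a (m j), inp, outp⟩ Q) :
    Leads P (N + 1) ⟨pc, m, inp, outp⟩ Q :=
  .step (by simp [RAM.step, h, Config.assign, hi]) h'

theorem Leads.jump {k j : ℕ} (h : P[pc]? = some (.jumpPos k j)) (hj : 0 < m j)
    (h' : Leads P N ⟨k, m, inp, outp⟩ Q) : Leads P (N + 1) ⟨pc, m, inp, outp⟩ Q :=
  .step (by simp [RAM.step, h, hj]) h'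

theorem Leads.pass {k j : ℕ} (h : P[pc]? = some (.jumpPos k j)) (hj : m j ≤ 0)
    (h' : Leads P N ⟨pc + 1, m, inp, outp⟩ Q) : Leads P (N + 1) ⟨pc, m, inp, outp⟩ Q :=
  .step (by simp [RAM.step, h, not_lt.2 hj]) h'

theorem Leads.read {i : ℕ} {v : ℤ} (h : P[pc]? = some (.read i))
    (h' : Leads P N ⟨pc + 1, Function.update m i v, inp, outp⟩ Q) :
    Leads P (N + 1) ⟨pc, m, v :: inp, outp⟩ Q :=
  .step (by simp [RAM.step, h, Config.assign]) h'

theorem Leads.print {i : ℕ} (h : P[pc]? = some (.print i))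
    (h' : Leads P N ⟨pc + 1, m, inp, outp ++ [m i]⟩ Q) :
    Leads P (N + 1) ⟨pc, m, inp, outp⟩ Q :=
  .step (by simp [RAM.step, h]) h'

/-- Forget how the contents of the registers have been obtained. -/
theorem Leads.generalize (h : ∀ m', m' = m → Leads P N ⟨pc, m', inp, outp⟩ Q) :
    Leads P N ⟨pc, m, inp, outp⟩ Q := h m rfl

end RAM

namespace InSeq

open RAM

/-! ### The program -/

/-- The program that reads the code of an instruction sequence and decides whether the result of
`scan` is accepted. The registers `X₉`, `X₁₀`, `X₁₃`, `X₁₅`, `X₁₆` and `X₁₇` hold the constants `1`,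
`4`, `2`, `40`, `0` and `17`, and `X₁₇₊ⱼ` holds the class of the instructions of form `j`. The
other registers below `X₄₀` are: the pointer `X₀`, which is `40 + 4p` at position `p`; the integer
read last `X₁`; the class `X₂` and the number `X₃` of the current instruction; the components of
the current `Scan`, being the kind `X₄`, the phase `X₅`, the flag `X₆`, the number `X₇` of the input
registers seen and the bound `X₈`; the scratch registers `X₁₁` and `X₁₂`; and the pointer `X₁₄` to
the end. The registers `40 + 4p`, `41 + 4p` and `42 + 4p` hold the class, the number and the kind
of position `p`, and the register `43 + 4x` tells whether `in:x` has been seen. -/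
def prog : List Instr := [
    -- 0: initialization
    .const 9 1, .const 10 4, .const 13 2, .const 17 17,
    .const 20 1, .const 26 1, .const 32 2, .const 25 3, .const 27 3, .const 28 3, .const 35 3,
    .const 24 4, .const 36 5, .const 30 6, .const 37 7,
    .const 0 40, .const 15 40,
    -- 17: read the next form; go to the second phase after the end marker
    .read 1, .jumpPos 21 1, .add 14 0 16, .jumpPos 29 9,
    -- 21: store the class and the number
    .add 11 1 17, .load 2 11, .read 3, .store 0 2, .add 11 0 9, .store 11 3, .add 0 0 10,
    .jumpPos 17 9,
    -- 29: go on with the preceding instruction, or decide if there is none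
    .sub 11 0 15, .jumpPos 45 11, .sub 11 8 7, .jumpPos 43 11, .sub 11 5 9, .jumpPos 37 11,
    .jumpPos 41 5, .jumpPos 43 9,
    -- 37: decide in a phase after the first
    .sub 11 11 9, .jumpPos 40 11, .jumpPos 43 9,
    -- 40: decide in the last phase
    .jumpPos 43 6,
    -- 41: accept
    .print 9, .halt,
    -- 43: reject
    .print 16, .halt,
    -- 45: fetch an instruction; the final instruction must be `!`
    .sub 0 0 10, .load 2 0, .add 11 0 9, .load 3 11, .jumpPos 56 5, .const 11 6, .sub 11 2 11,
    .jumpPos 54 11, .jumpPos 43 9,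
    -- 54: the final instruction is `!`
    .const 5 1, .jumpPos 29 9,
    -- 56: distinguish the other phases
    .sub 11 5 9, .jumpPos 59 11, .jumpPos 94 9,
    -- 59: a positive test is expected
    .sub 11 11 9, .jumpPos 67 11, .sub 11 2 10, .jumpPos 43 11, .sub 11 10 2, .jumpPos 43 11,
    .const 5 3, .jumpPos 76 9,
    -- 67: a negative test, or the last instruction of a block if this is the first time
    .const 11 5, .sub 11 2 11, .jumpPos 73 11, .jumpPos 43 6, .const 6 1, .jumpPos 94 9,
    -- 73: check that it is a negative test
    .sub 11 11 9, .jumpPos 43 11, .const 5 1,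
    -- 76: a test of a block, which must be new and different from the current kind
    .add 11 3 3, .add 11 11 11, .const 12 43, .add 11 11 12, .load 12 11, .jumpPos 43 12,
    .sub 12 4 3, .jumpPos 87 12, .sub 12 3 4, .jumpPos 87 12, .jumpPos 43 9,
    -- 87: record it
    .store 11 9, .add 7 7 9, .sub 12 3 8, .jumpPos 92 12, .jumpPos 29 9,
    -- 92: adjust the bound
    .add 8 3 16, .jumpPos 29 9,
    -- 94: the last instruction of a block: class `1`
    .const 5 2, .sub 11 2 9, .jumpPos 99 11, .jumpPos 146 2, .jumpPos 43 9,
    -- 99: class `2`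
    .sub 11 11 9, .jumpPos 106 11, .sub 11 14 0, .sub 11 11 10, .sub 11 11 10, .jumpPos 146 11,
    .jumpPos 43 9,
    -- 106: classes `3` and `4`
    .sub 11 2 10, .jumpPos 128 11, .const 12 10, .add 12 0 12, .load 12 12, .sub 12 16 12,
    .jumpPos 114 12, .jumpPos 43 9,
    -- 114: the position after the next one has a negative kind
    .sub 11 10 2, .jumpPos 146 11, .sub 12 3 8, .jumpPos 119 12, .jumpPos 120 9,
    -- 119: adjust the bound
    .add 8 3 16,
    -- 120: class `4`
    .add 11 3 3, .add 11 11 11, .const 12 43, .add 11 11 12, .load 11 11, .jumpPos 146 11,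
    .add 4 3 16, .jumpPos 147 9,
    -- 128: class `5`
    .sub 11 11 9, .jumpPos 43 11, .add 11 3 3, .add 11 11 11, .add 11 11 0, .add 11 11 13,
    .load 4 11, .jumpPos 139 4, .sub 11 16 4, .jumpPos 147 11, .jumpPos 43 9,
    -- 139: the target has a positive kind
    .add 11 4 4, .add 11 11 11, .const 12 43, .add 11 11 12, .load 11 11, .jumpPos 43 11,
    .jumpPos 147 9,
    -- 146: the kind is `-1`
    .const 4 (-1),
    -- 147: save the kind
    .add 11 0 13, .store 11 4, .jumpPos 29 9]

/-- The contents of the registers in the second loop of the program: `q` is the position the pointer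
is at, `ph`, `u`, `cur`, `mx` and `S` are the components of the current `Scan`, `cnt` is the number
of elements of `S`, and `κ` gives the kinds of the positions. -/
structure Mem (X : List PInstr) (q : ℕ) (ph u cur : ℤ) (cnt mx : ℕ) (κ : ℕ → ℤ) (S : Finset ℕ)
    (m : ℕ → ℤ) : Prop where
  ptr : m 0 = (40 + 4 * q : ℕ)
  cur : m 4 = cur
  phase : m 5 = ph
  used : m 6 = u
  cnt : m 7 = cnt
  mx : m 8 = mx
  one : m 9 = 1
  four : m 10 = 4
  two : m 13 = 2
  fin : m 14 = (40 + 4 * X.length : ℕ)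
  base : m 15 = 40
  zero : m 16 = 0
  cls : ∀ p I, X[p]? = some I → m (40 + 4 * p) = I.cls
  num : ∀ p I, X[p]? = some I → m (41 + 4 * p) = I.num
  kind : ∀ p, m (42 + 4 * p) = κ p
  seen : ∀ x, m (43 + 4 * x) = if x ∈ S then 1 else 0

section Mem

variable {X : List PInstr} {q : ℕ} {ph u cur : ℤ} {cnt mx : ℕ} {κ : ℕ → ℤ} {S : Finset ℕ}
  {m : ℕ → ℤ}

theorem update_add_mul_of_lt (m : ℕ → ℤ) {i a : ℕ} (v : ℤ) (p : ℕ) (h : i < a) :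
    Function.update m i v (a + 4 * p) = m (a + 4 * p) :=
  Function.update_of_ne (by omega) _ _

theorem Mem.scratch (h : Mem X q ph u cur cnt mx κ S m) {i : ℕ} (v : ℤ)
    (hi : i = 1 ∨ i = 2 ∨ i = 3 ∨ i = 11 ∨ i = 12 := by decide) :
    Mem X q ph u cur cnt mx κ S (Function.update m i v) := by
  have hlt : ∀ a, a ∈ [0, 4, 5, 6, 7, 8, 9, 10, 13, 14, 15, 16] → a ≠ i := by
    rcases hi with rfl | rfl | rfl | rfl | rfl <;> decide
  have hi' : i < 40 := by omega
  constructor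
  case cls => intro p I hp; rw [update_add_mul_of_lt _ _ _ (by omega), h.cls p I hp]
  case num => intro p I hp; rw [update_add_mul_of_lt _ _ _ (by omega), h.num p I hp]
  case kind => intro p; rw [update_add_mul_of_lt _ _ _ (by omega), h.kind p]
  case seen => intro p; rw [update_add_mul_of_lt _ _ _ (by omega), h.seen p]
  all_goals rw [Function.update_of_ne (hlt _ (by decide))]
  exacts [h.ptr, h.cur, h.phase, h.used, h.cnt, h.mx, h.one, h.four, h.two, h.fin, h.base, h.zero]

theorem Mem.set_ptr (h : Mem X q ph u cur cnt mx κ S m) (r : ℕ) {v : ℤ}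
    (hv : v = (40 + 4 * r : ℕ)) : Mem X r ph u cur cnt mx κ S (Function.update m 0 v) := by
  subst hv
  constructor <;> simp [h.cur, h.phase, h.used, h.cnt, h.mx, h.one, h.four, h.two, h.fin, h.base,
    h.zero, h.kind, h.seen]
  exacts [h.cls, h.num]

theorem Mem.set_cur (h : Mem X q ph u cur cnt mx κ S m) (v : ℤ) :
    Mem X q ph u v cnt mx κ S (Function.update m 4 v) := by
  constructor <;> simp [h.ptr, h.phase, h.used, h.cnt, h.mx, h.one, h.four, h.two, h.fin, h.base,
    h.zero, update_add_mul_of_lt, h.kind, h.seen]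
  exacts [h.cls, h.num]

theorem Mem.set_phase (h : Mem X q ph u cur cnt mx κ S m) (v : ℤ) :
    Mem X q v u cur cnt mx κ S (Function.update m 5 v) := by
  constructor <;> simp [h.ptr, h.cur, h.used, h.cnt, h.mx, h.one, h.four, h.two, h.fin, h.base,
    h.zero, update_add_mul_of_lt, h.kind, h.seen]
  exacts [h.cls, h.num]

theorem Mem.set_used (h : Mem X q ph u cur cnt mx κ S m) (v : ℤ) :
    Mem X q ph v cur cnt mx κ S (Function.update m 6 v) := by
  constructor <;> simp [h.ptr, h.cur, h.phase, h.cnt, h.mx, h.one, h.four, h.two, h.fin, h.base,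
    h.zero, update_add_mul_of_lt, h.kind, h.seen]
  exacts [h.cls, h.num]

theorem Mem.set_cnt (h : Mem X q ph u cur cnt mx κ S m) {v : ℤ} (n : ℕ) (hv : v = n) :
    Mem X q ph u cur n mx κ S (Function.update m 7 v) := by
  subst hv
  constructor <;> simp [h.ptr, h.cur, h.phase, h.used, h.mx, h.one, h.four, h.two, h.fin, h.base,
    h.zero, update_add_mul_of_lt, h.kind, h.seen]
  exacts [h.cls, h.num]

theorem Mem.set_mx (h : Mem X q ph u cur cnt mx κ S m) {v : ℤ} (n : ℕ) (hv : v = n) :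
    Mem X q ph u cur cnt n κ S (Function.update m 8 v) := by
  subst hv
  constructor <;> simp [h.ptr, h.cur, h.phase, h.used, h.cnt, h.one, h.four, h.two, h.fin, h.base,
    h.zero, update_add_mul_of_lt, h.kind, h.seen]
  exacts [h.cls, h.num]

theorem Mem.set_kind (h : Mem X q ph u cur cnt mx κ S m) (p : ℕ) (v : ℤ) :
    Mem X q ph u cur cnt mx (Function.update κ p v) S (Function.update m (42 + 4 * p) v) := by
  have hne : ∀ a, a < 40 → a ≠ 42 + 4 * p := by omega
  constructor
  case cls => intro r I hr; rw [Function.update_of_ne (by omega), h.cls r I hr]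
  case num => intro r I hr; rw [Function.update_of_ne (by omega), h.num r I hr]
  case kind =>
    intro r
    by_cases hr : r = p
    · simp [hr]
    · rw [Function.update_of_ne (by omega), Function.update_of_ne hr, h.kind]
  case seen => intro r; rw [Function.update_of_ne (by omega), h.seen r]
  all_goals rw [Function.update_of_ne (hne _ (by decide))]
  exacts [h.ptr, h.cur, h.phase, h.used, h.cnt, h.mx, h.one, h.four, h.two, h.fin, h.base, h.zero]

theorem Mem.set_seen (h : Mem X q ph u cur cnt mx κ S m) (x : ℕ) {v : ℤ} (hv : v = 1) :
    Mem X q ph u cur cnt mx κ (insert x S) (Function.update m (43 + 4 * x) v) := by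
  have hne : ∀ a, a < 40 → a ≠ 43 + 4 * x := by omega
  constructor
  case cls => intro r I hr; rw [Function.update_of_ne (by omega), h.cls r I hr]
  case num => intro r I hr; rw [Function.update_of_ne (by omega), h.num r I hr]
  case kind => intro r; rw [Function.update_of_ne (by omega), h.kind r]
  case seen =>
    intro r
    by_cases hr : r = x
    · simp [hr, hv]
    · rw [Function.update_of_ne (by omega), h.seen]
      simp [hr]
  all_goals rw [Function.update_of_ne (hne _ (by decide))]
  exacts [h.ptr, h.cur, h.phase, h.used, h.cnt, h.mx, h.one, h.four, h.two, h.fin, h.base, h.zero]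

end Mem

/-- The content of `X₅` for each phase. -/
def Phase.code : Phase → ℤ
  | .term => 0
  | .act => 1
  | .pos => 2
  | .opt => 3

/-- The kinds, as a function of the position, if the positions from `q` on have been read. -/
def kindsFrom (q : ℕ) (l : List ℤ) (p : ℕ) : ℤ := if p < q then 0 else l.getD (p - q) 0

/-- The registers hold the result `σ` of reading the instructions from position `q` on. -/
def Holds (X : List PInstr) (q : ℕ) (σ : Scan) (m : ℕ → ℤ) : Prop :=
  Mem X q σ.phase.code (if σ.used then 1 else 0) σ.cur σ.seen.card σ.mx (kindsFrom q σ.kinds)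
    σ.seen m

/-- The program is about to reject, or to go on with the result of reading one instruction. -/
def Reading (X : List PInstr) (q : ℕ) (o : Option Scan) (c : Config) : Prop :=
  ∃ m, match o with
    | some σ => c = ⟨29, m, [], []⟩ ∧ Holds X q σ m
    | none => c = ⟨43, m, [], []⟩ ∧ m 16 = 0

theorem kindsFrom_cons_zero (q : ℕ) (l : List ℤ) : kindsFrom q (0 :: l) = kindsFrom (q + 1) l := by
  funext p
  unfold kindsFrom
  rcases lt_trichotomy p q with h | h | h
  · rw [if_pos h, if_pos (by omega)]
  · simp [h]
  · rw [if_neg (by omega), if_neg (by omega), show p - q = p - (q + 1) + 1 by omega,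
      List.getD_cons_succ]

theorem kindsFrom_cons (q : ℕ) (k : ℤ) (l : List ℤ) :
    kindsFrom q (k :: l) = Function.update (kindsFrom (q + 1) l) q k := by
  funext p
  by_cases h : p = q
  · simp [h, kindsFrom]
  · rw [Function.update_of_ne h, ← kindsFrom_cons_zero]
    unfold kindsFrom
    split_ifs
    · rfl
    · rw [show p - q = p - q - 1 + 1 by omega, List.getD_cons_succ, List.getD_cons_succ]

theorem kindsFrom_add (q d : ℕ) (σ : Scan) : kindsFrom (q + 1) σ.kinds (q + d) = σ.kindAt d := by
  rw [← kindsFrom_cons_zero, kindsFrom, if_neg (by omega), Nat.add_sub_cancel_left]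
  rfl

/-- The registers hold the result `σ` of reading the instructions after position `q`, except for the
phase and the flag, which are `ph` and `u`, and the pointer is at position `q`. -/
abbrev Ready (X : List PInstr) (q : ℕ) (ph : Phase) (u : Bool) (σ : Scan) (m : ℕ → ℤ) : Prop :=
  Mem X q ph.code (if u then 1 else 0) σ.cur σ.seen.card σ.mx (kindsFrom (q + 1) σ.kinds) σ.seen m

theorem leads_reject {X : List PInstr} {q N : ℕ} {m : ℕ → ℤ} (h : m 16 = 0) :
    Leads prog N ⟨43, m, [], []⟩ (Reading X q none) :=
  .done ⟨m, rfl, h⟩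

/-- The part of the program from label `76` on performs `Scan.test`. -/
theorem leads_test {X : List PInstr} {q x : ℕ} {σ : Scan} {ph : Phase} {m : ℕ → ℤ}
    (h : Ready X q ph σ.used σ m) (hx : m 3 = x) :
    Leads prog 20 ⟨76, m, [], []⟩ (Reading X q (σ.test x ph)) := by
  refine .add rfl (.add rfl (.const rfl (.add rfl (.load (a := 43 + 4 * x) rfl ?_
    (.generalize fun m₁ e₁ => ?_)))))
  · simp [hx]; ring
  have h₁ : Ready X q ph σ.used σ m₁ := by
    rw [e₁]
    exact ((((h.scratch _).scratch _).scratch _).scratch _).scratch _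
  have hx₁ : m₁ 3 = x := by simp [e₁, hx]
  have ha : m₁ 11 = (43 + 4 * x : ℕ) := by simp [e₁, hx]; ring
  have hs : m₁ 12 = if x ∈ σ.seen then 1 else 0 := by simp [e₁, update_add_mul_of_lt, h.seen x]
  clear e₁ h
  by_cases hxs : x ∈ σ.seen
  · refine .jump rfl (by simp [hs, hxs]) ?_
    rw [Scan.test, if_pos (Or.inl hxs)]
    exact leads_reject h₁.zero
  refine .pass rfl (by simp [hs, hxs]) ?_
  by_cases hc : σ.cur = x
  · refine .sub rfl (.pass rfl ?_ (.sub rfl (.pass rfl ?_ (.jump rfl ?_ ?_))))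
    · simp [h₁.cur, hx₁, hc]
    · simp [h₁.cur, hx₁, hc]
    · simp [h₁.one]
    · rw [Scan.test, if_pos (Or.inr hc)]
      exact leads_reject (by simp [h₁.zero])
  rw [Scan.test, if_neg (by tauto)]
  -- The two comparisons of the test with the current kind lead to the same label.
  have hnew : ∀ m : ℕ → ℤ, Ready X q ph σ.used σ m → m 3 = x → m 11 = (43 + 4 * x : ℕ) →
      Leads prog 10 ⟨87, m, [], []⟩ (Reading X q (some
        ⟨ph, σ.used, σ.cur, 0 :: σ.kinds, insert x σ.seen, max σ.mx x⟩)) := by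
    intro m h hx ha
    refine .store rfl ha (.add rfl (.sub rfl (.generalize fun m₁ e₁ => ?_)))
    have h₁ := ((h.set_seen x h.one).set_cnt (insert x σ.seen).card (v := m 7 + m 9) (by
      rw [Finset.card_insert_of_notMem hxs, h.cnt, h.one]; push_cast; ring)).scratch
      (i := 12) (m 3 - m 8)
    have hne : ∀ i, i < 43 → i ≠ 43 + 4 * x := by omega
    have h7 := Function.update_of_ne (hne 7 (by decide)) (m 9) m
    have h9 := Function.update_of_ne (hne 9 (by decide)) (m 9) m
    have h3 := Function.update_of_ne (hne 3 (by decide)) (m 9) m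
    have h8 := Function.update_of_ne (hne 8 (by decide)) (m 9) m
    simp only [h7, h9, Function.update_of_ne (show 3 ≠ 7 by decide),
      Function.update_of_ne (show 8 ≠ 7 by decide), h3, h8] at e₁
    rw [← e₁] at h₁
    have hx₁ : m₁ 3 = x := by simp [e₁, h3, hx]
    have hd : m₁ 12 = x - σ.mx := by simp [e₁, hx, h.mx]
    clear e₁
    by_cases hlt : σ.mx < x
    · refine .jump rfl (by rw [hd]; omega) (.add rfl (.jump rfl (by simp [h₁.one]) ?_))
      have := h₁.set_mx (v := m₁ 3 + m₁ 16) (max σ.mx x) (by rw [hx₁, h₁.zero]; push_cast; omega)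
      exact .done ⟨_, rfl, by simpa only [Holds, kindsFrom_cons_zero] using this⟩
    · refine .pass rfl (by rw [hd]; omega) (.jump rfl (by simp [h₁.one]) ?_)
      refine .done ⟨_, rfl, ?_⟩
      rw [Holds, max_eq_left (not_lt.1 hlt)]
      simpa only [kindsFrom_cons_zero] using h₁
  refine .sub rfl (.generalize fun m₂ e₂ => ?_)
  have h₂ := h₁.scratch (i := 12) (m₁ 4 - m₁ 3)
  rw [← e₂] at h₂
  have hx₂ : m₂ 3 = x := by simp [e₂, hx₁]
  have ha₂ : m₂ 11 = (43 + 4 * x : ℕ) := by rw [e₂, ← ha]; simp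
  have hd : m₂ 12 = σ.cur - x := by simp [e₂, h₁.cur, hx₁]
  rcases lt_or_gt_of_ne hc with hlt | hlt
  · refine .pass rfl (by rw [hd]; omega) (.sub rfl (.jump rfl ?_ ?_))
    · simp [h₂.cur, hx₂]; omega
    · exact (hnew _ (h₂.scratch _) (by simp [hx₂]) (by simpa using ha₂)).mono (by decide)
  · exact .jump rfl (by rw [hd]; omega) ((hnew _ h₂ hx₂ ha₂).mono (by decide))

/-- The part of the program from label `147` on stores the kind of the current position. -/
theorem leads_save {X : List PInstr} {q M : ℕ} {u : Bool} {k : ℤ} {σ : Scan} {m : ℕ → ℤ}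
    (h : Ready X q .pos u { σ with cur := k, mx := M } m) :
    Leads prog 3 ⟨147, m, [], []⟩
      (Reading X q (some ⟨.pos, u, k, k :: σ.kinds, σ.seen, M⟩)) := by
  refine .add rfl (.store (a := 42 + 4 * q) rfl ?_ (.jump rfl ?_ (.done ⟨_, rfl, ?_⟩)))
  · simp [h.ptr, h.two]; ring
  · rw [Function.update_of_ne (by omega)]
    simp [h.one]
  · have := (h.scratch (i := 11) (m 0 + m 13)).set_kind q k
    rw [Holds, kindsFrom_cons]
    simpa [h.cur] using this

theorem leads_always {X : List PInstr} {q M : ℕ} {u : Bool} {σ : Scan} {m : ℕ → ℤ}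
    (h : Ready X q .pos u { σ with mx := M } m) :
    Leads prog 4 ⟨146, m, [], []⟩
      (Reading X q (some ⟨.pos, u, -1, -1 :: σ.kinds, σ.seen, M⟩)) :=
  .const rfl (leads_save (h.set_cur (-1)))

/-- The part of the program from label `94` on performs `Scan.action`. -/
theorem leads_action {X : List PInstr} {q : ℕ} {ph : Phase} {u : Bool} {σ : Scan} {I : PInstr}
    {m : ℕ → ℤ} (h : Ready X q ph u σ m) (hc : m 2 = I.cls) (hn : m 3 = I.num)
    (hlen : q + 1 + σ.kinds.length = X.length) :
    Leads prog 40 ⟨94, m, [], []⟩ (Reading X q (σ.action I u)) := by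
  refine .const rfl (.sub rfl (.generalize fun m₁ e₁ => ?_))
  have h₁ : Ready X q .pos u σ m₁ := by
    rw [e₁]
    exact (h.set_phase _).scratch _
  have hc₁ : m₁ 2 = I.cls := by simp [e₁, hc]
  have hn₁ : m₁ 3 = I.num := by simp [e₁, hn]
  have hd₁ : m₁ 11 = I.cls - 1 := by simp [e₁, hc, h.one]
  clear e₁ h hc hn
  have h7 := cls_le_seven I
  have hact : ∀ k, σ.kindOf I = k → k ≠ 0 → I.cls ≠ 4 → σ.action I u =
      some ⟨.pos, u, k, k :: σ.kinds, σ.seen, σ.mx⟩ := by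
    rintro k rfl hk h4
    rw [Scan.action, if_neg hk, if_neg h4]
  have hrej : σ.kindOf I = 0 → σ.action I u = none := fun hk => by rw [Scan.action, if_pos hk]
  by_cases hle : I.cls ≤ 1
  · refine .pass rfl (by omega) ?_
    by_cases h1 : I.cls = 1
    · rw [hact (-1) (by simp [Scan.kindOf, h1]) (by decide) (by omega)]
      exact .jump rfl (by omega) ((leads_always h₁).mono (by decide))
    · rw [hrej (by simp [Scan.kindOf, show I.cls = 0 by omega])]
      exact .pass rfl (by omega) (.jump rfl (by simp [h₁.one]) (leads_reject h₁.zero))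
  refine .jump rfl (by omega) (.sub rfl (.generalize fun m₂ e₂ => ?_))
  have h₂ : Ready X q .pos u σ m₂ := by
    rw [e₂]
    exact h₁.scratch _
  have hc₂ : m₂ 2 = I.cls := by simp [e₂, hc₁]
  have hn₂ : m₂ 3 = I.num := by simp [e₂, hn₁]
  have hd₂ : m₂ 11 = I.cls - 2 := by simp [e₂, hd₁, h₁.one]; ring
  clear e₂ h₁ hc₁ hn₁ hd₁ m₁
  by_cases hle2 : I.cls ≤ 2
  · have hcls : I.cls = 2 := by omega
    refine .pass rfl (by omega) (.sub rfl (.sub rfl (.sub rfl (.generalize fun m₃ e₃ => ?_))))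
    have h₃ : Ready X q .pos u σ m₃ := by
      rw [e₃]
      exact ((h₂.scratch _).scratch _).scratch _
    have hd₃ : m₃ 11 = 4 * (σ.kinds.length - 1) := by
      simp [e₃, h₂.fin, h₂.four, h₂.ptr, ← hlen]; ring
    by_cases hl : 2 ≤ σ.kinds.length
    · rw [hact (-1) (by simp [Scan.kindOf, hcls, hl]) (by decide) (by omega)]
      exact .jump rfl (by omega) ((leads_always h₃).mono (by decide))
    · rw [hrej (by simp [Scan.kindOf, hcls, hl])]
      exact .pass rfl (by omega) (.jump rfl (by simp [h₃.one]) (leads_reject h₃.zero))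
  refine .jump rfl (by omega) (.sub rfl (.generalize fun m₃ e₃ => ?_))
  have h₃ : Ready X q .pos u σ m₃ := by
    rw [e₃]
    exact h₂.scratch _
  have hc₃ : m₃ 2 = I.cls := by simp [e₃, hc₂]
  have hn₃ : m₃ 3 = I.num := by simp [e₃, hn₂]
  have hd₃ : m₃ 11 = I.cls - 4 := by simp [e₃, hc₂, h₂.four]
  clear e₃ h₂ hc₂ hn₂ hd₂ m₂
  by_cases hle4 : I.cls ≤ 4
  · refine .pass rfl (by omega) (.const rfl (.add rfl (.load (a := 42 + 4 * (q + 2)) rfl ?_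
      (.sub rfl (.generalize fun m₄ e₄ => ?_)))))
    · simp [h₃.ptr]; ring
    have h₄ : Ready X q .pos u σ m₄ := by
      rw [e₄]
      exact (((h₃.scratch _).scratch _).scratch _).scratch _
    have hc₄ : m₄ 2 = I.cls := by simp [e₄, hc₃]
    have hn₄ : m₄ 3 = I.num := by simp [e₄, hn₃]
    have hd₄ : m₄ 12 = -σ.kindAt 2 := by
      rw [e₄, ← kindsFrom_add q, ← h₃.kind]
      simp only [Function.update_self, Function.update_of_ne (show 16 ≠ 12 by decide), h₃.zero,
        update_add_mul_of_lt _ _ _ (show 12 < 42 by decide)]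
      ring
    clear e₄ h₃ hc₃ hn₃ hd₃ m₃
    by_cases hk2 : σ.kindAt 2 < 0
    swap
    · rw [hrej]
      · exact .pass rfl (by omega) (.jump rfl (by simp [h₄.one]) (leads_reject h₄.zero))
      · obtain h | h : I.cls = 3 ∨ I.cls = 4 := by omega
        · simp [Scan.kindOf, h, hk2]
        · simp [Scan.kindOf, h, hk2]
    refine .jump rfl (by omega) (.sub rfl (.generalize fun m₅ e₅ => ?_))
    have h₅ : Ready X q .pos u σ m₅ := by
      rw [e₅]
      exact h₄.scratch _
    have hn₅ : m₅ 3 = I.num := by simp [e₅, hn₄]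
    have hd₅ : m₅ 11 = 4 - I.cls := by simp [e₅, hc₄, h₄.four]
    clear e₅ h₄ hc₄ hn₄ hd₄ m₄
    by_cases h3 : I.cls = 3
    · rw [hact (-1) (by simp [Scan.kindOf, h3, hk2]) (by decide) (by omega)]
      exact .jump rfl (by omega) ((leads_always h₅).mono (by decide))
    have h4 : I.cls = 4 := by omega
    obtain ⟨x, rfl⟩ := eq_pos_of_cls h4
    replace hn₅ : m₅ 3 = (x : ℕ) := hn₅
    -- What follows the adjustment of the bound.
    have hfin : ∀ m, Ready X q .pos u { σ with mx := max σ.mx x } m → m 3 = (x : ℕ) →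
        Leads prog 15 ⟨120, m, [], []⟩ (Reading X q (σ.action (.pos (.inGet x)) u)) := by
      intro m h hx
      refine .add rfl (.add rfl (.const rfl (.add rfl (.load (a := 43 + 4 * x) rfl ?_
        (.generalize fun m' e => ?_)))))
      · simp [hx]; ring
      have h' : Ready X q .pos u { σ with mx := max σ.mx x } m' := by
        rw [e]
        exact ((((h.scratch _).scratch _).scratch _).scratch _).scratch _
      have hx' : m' 3 = (x : ℕ) := by simp [e, hx]
      have hs : m' 11 = if (x : ℕ) ∈ σ.seen then 1 else 0 := by
        simp [e, update_add_mul_of_lt, h.seen x]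
      clear e
      by_cases hxs : (x : ℕ) ∈ σ.seen
      · have : σ.action (.pos (.inGet x)) u =
            some ⟨.pos, u, -1, -1 :: σ.kinds, σ.seen, max σ.mx x⟩ := by
          simp [Scan.action, Scan.kindOf, h4, hk2, hxs]
        rw [this]
        exact .jump rfl (by simp [hs, hxs]) ((leads_always h').mono (by decide))
      · have : σ.action (.pos (.inGet x)) u =
            some ⟨.pos, u, (x : ℕ), (x : ℕ) :: σ.kinds, σ.seen, max σ.mx x⟩ := by
          simp [Scan.action, Scan.kindOf, h4, hk2, hxs]
        rw [this]
        refine .pass rfl (by simp [hs, hxs]) (.add rfl (.jump rfl (by simp [h'.one]) ?_))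
        refine (leads_save ?_).mono (by decide)
        rw [show m' 3 + m' 16 = (x : ℕ) by rw [hx', h'.zero, add_zero]]
        exact h'.set_cur _
    refine .pass rfl (by omega) (.sub rfl (.generalize fun m₆ e₆ => ?_))
    have h₆ : Ready X q .pos u σ m₆ := by
      rw [e₆]
      exact h₅.scratch _
    have hn₆ : m₆ 3 = (x : ℕ) := by simp [e₆, hn₅]
    have hd₆ : m₆ 12 = (x : ℕ) - σ.mx := by simp [e₆, hn₅, h₅.mx]
    clear e₆
    by_cases hlt : σ.mx < x
    · refine .jump rfl (by omega) (.add rfl ((hfin _ ?_ ?_).mono (by decide)))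
      · exact h₆.set_mx _ (by rw [hn₆, h₆.zero]; push_cast; omega)
      · simp [hn₆]
    · refine .pass rfl (by omega) (.jump rfl (by simp [h₆.one]) ((hfin _ ?_ hn₆).mono (by decide)))
      rw [max_eq_left (not_lt.1 hlt)]
      exact h₆
  refine .jump rfl (by omega) (.sub rfl (.generalize fun m₄ e₄ => ?_))
  have h₄ : Ready X q .pos u σ m₄ := by
    rw [e₄]
    exact h₃.scratch _
  have hn₄ : m₄ 3 = I.num := by simp [e₄, hn₃]
  have hd₄ : m₄ 11 = I.cls - 5 := by simp [e₄, hd₃, h₃.one]; ring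
  clear e₄ h₃ hc₃ hn₃ hd₃ m₃
  by_cases h5 : I.cls = 5
  swap
  · rw [hrej]
    · exact .jump rfl (by omega) (leads_reject h₄.zero)
    · obtain h | h : I.cls = 6 ∨ I.cls = 7 := by omega
      · simp [Scan.kindOf, h]
      · simp [Scan.kindOf, h]
  obtain ⟨l, rfl⟩ := eq_jump_of_cls h5
  replace hn₄ : m₄ 3 = (l : ℤ) := hn₄
  refine .pass rfl (by omega) (.add rfl (.add rfl (.add rfl (.add rfl
    (.load (a := 42 + 4 * (q + l)) rfl ?_ (.generalize fun m₅ e₅ => ?_))))))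
  · simp [hn₄, h₄.ptr, h₄.two]; ring
  have h₅ : Ready X q .pos u { σ with cur := σ.kindAt l } m₅ := by
    rw [e₅]
    have := ((((h₄.scratch (i := 11) (m₄ 3 + m₄ 3)).scratch (i := 11)
      (m₄ 3 + m₄ 3 + (m₄ 3 + m₄ 3))).scratch (i := 11)
      (m₄ 3 + m₄ 3 + (m₄ 3 + m₄ 3) + m₄ 0)).scratch (i := 11)
      (m₄ 3 + m₄ 3 + (m₄ 3 + m₄ 3) + m₄ 0 + m₄ 13)).set_cur (σ.kindAt l)
    convert this using 2
    · simp
    · rw [update_add_mul_of_lt _ _ _ (by decide), update_add_mul_of_lt _ _ _ (by decide),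
        update_add_mul_of_lt _ _ _ (by decide), update_add_mul_of_lt _ _ _ (by decide),
        h₄.kind, kindsFrom_add]
  clear e₅
  have hcur₅ : m₅ 4 = σ.kindAt l := h₅.cur
  have hkind : σ.kindOf (.jump l) = if 0 < σ.kindAt l ∧ (σ.kindAt l).toNat ∈ σ.seen then 0
      else σ.kindAt l := rfl
  by_cases hpos : 0 < σ.kindAt l
  · have hcast : σ.kindAt l = ((σ.kindAt l).toNat : ℤ) := by omega
    refine .jump rfl (by omega) (.add rfl (.add rfl (.const rfl (.add rfl
      (.load (a := 43 + 4 * (σ.kindAt l).toNat) rfl ?_ (.generalize fun m₆ e₆ => ?_))))))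
    · simp [h₅.cur]; rw [max_eq_left hpos.le]; ring
    have h₆ : Ready X q .pos u { σ with cur := σ.kindAt l } m₆ := by
      rw [e₆]
      exact ((((h₅.scratch _).scratch _).scratch _).scratch _).scratch _
    have hs : m₆ 11 = if (σ.kindAt l).toNat ∈ σ.seen then 1 else 0 := by
      rw [← h₅.seen, e₆, Function.update_self]
      simp only [update_add_mul_of_lt _ _ _ (show 11 < 43 by decide),
        update_add_mul_of_lt _ _ _ (show 12 < 43 by decide)]
    by_cases hxs : (σ.kindAt l).toNat ∈ σ.seen
    · rw [hrej (by rw [hkind, if_pos ⟨hpos, hxs⟩])]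
      exact .jump rfl (by simp [hs, hxs]) (leads_reject h₆.zero)
    · rw [hact _ (by rw [hkind, if_neg (by tauto)]) hpos.ne' (by simp [h5])]
      refine .pass rfl (by simp [hs, hxs]) (.jump rfl (by simp [h₆.one]) ?_)
      exact (leads_save h₆).mono (by decide)
  · refine .pass rfl (by omega) (.sub rfl (.generalize fun m₆ e₆ => ?_))
    have h₆ : Ready X q .pos u { σ with cur := σ.kindAt l } m₆ := by
      rw [e₆]
      exact h₅.scratch _
    have hd₆ : m₆ 11 = -σ.kindAt l := by simp [e₆, h₅.cur, h₅.zero]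
    have hk : σ.kindOf (.jump l) = σ.kindAt l := by rw [hkind, if_neg (by tauto)]
    by_cases h0 : σ.kindAt l = 0
    · rw [hrej (hk.trans h0)]
      exact .pass rfl (by omega) (.jump rfl (by simp [h₆.one]) (leads_reject h₆.zero))
    · rw [hact _ hk h0 (by simp [h5])]
      exact .jump rfl (by omega) ((leads_save h₆).mono (by decide))

/-! ### The correctness of the program -/

theorem num_of_cls {I : PInstr} (h : I.cls = 4 ∨ I.cls = 6) : I.num = I.arg := by
  rcases h with h | h
  · obtain ⟨x, rfl⟩ := eq_pos_of_cls h
    rfl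
  · obtain ⟨x, rfl⟩ := eq_neg_of_cls h
    rfl

/-- One round of the second loop of the program reads one instruction. -/
theorem leads_step {X : List PInstr} {q : ℕ} {σ : Scan} {I : PInstr} {m : ℕ → ℤ}
    (h : Holds X (q + 1) σ m) (hI : X[q]? = some I)
    (hlen : q + 1 + σ.kinds.length = X.length) :
    Leads prog 60 ⟨29, m, [], []⟩ (Reading X q (σ.step I)) := by
  refine .sub rfl (.jump rfl ?_ (.sub rfl (.load (a := 40 + 4 * q) rfl ?_
    (.add rfl (.load (a := 41 + 4 * q) rfl ?_ (.generalize fun m₁ e₁ => ?_))))))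
  · simp [h.ptr, h.base]
  · simp [h.ptr, h.four]; ring
  · simp [h.ptr, h.four, h.one]; ring
  have hp : m 0 - m 10 = (40 + 4 * q : ℕ) := by rw [h.ptr, h.four]; push_cast; ring
  have h₁ : Ready X q σ.phase σ.used σ m₁ := by
    rw [e₁]
    refine (((Mem.set_ptr (h.scratch (i := 11) (m 0 - m 15)) q ?_).scratch _).scratch _).scratch _
    simpa using hp
  have hc : m₁ 2 = I.cls := by
    rw [← h.cls q I hI, e₁]
    simp only [Function.update_of_ne (show 2 ≠ 3 by decide),
      Function.update_of_ne (show 2 ≠ 11 by decide), Function.update_self]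
    rw [update_add_mul_of_lt _ _ _ (by decide), update_add_mul_of_lt _ _ _ (by decide)]
  have hn : m₁ 3 = I.num := by
    rw [← h.num q I hI, e₁, Function.update_self, update_add_mul_of_lt _ _ _ (by decide),
      update_add_mul_of_lt _ _ _ (by decide), update_add_mul_of_lt _ _ _ (by decide),
      update_add_mul_of_lt _ _ _ (by decide)]
  clear e₁ h hp
  have h7 := cls_le_seven I
  rcases hph : σ.phase
  · rw [hph] at h₁
    refine .pass rfl (by rw [h₁.phase]; simp [Phase.code]) (.const rfl (.sub rfl
      (.generalize fun m₂ e₂ => ?_)))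
    have h₂ : Ready X q .term σ.used σ m₂ := by
      rw [e₂]
      exact (h₁.scratch _).scratch _
    have hd : m₂ 11 = I.cls - 6 := by simp [e₂, hc]
    by_cases hI7 : I.cls = 7
    · refine .jump rfl (by omega) (.const rfl (.jump rfl (by simp [h₂.one]) (.done ?_)))
      simp only [Scan.step, hph, if_pos hI7]
      refine ⟨_, rfl, ?_⟩
      simpa only [Holds, kindsFrom_cons_zero, Phase.code] using h₂.set_phase 1
    · refine .pass rfl (by omega) (.jump rfl (by simp [h₂.one]) ?_)
      simp only [Scan.step, hph, if_neg hI7]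
      exact leads_reject h₂.zero
  · rw [hph] at h₁
    refine .jump rfl (by rw [h₁.phase]; decide) (.sub rfl (.pass rfl ?_ (.jump rfl ?_ ?_)))
    · simp [h₁.phase, h₁.one, Phase.code]
    · simp [h₁.one]
    simp only [Scan.step, hph]
    exact (leads_action (h₁.scratch _) (by simp [hc]) (by simp [hn]) hlen).mono (by decide)
  · rw [hph] at h₁
    refine .jump rfl (by rw [h₁.phase]; decide) (.sub rfl (.jump rfl ?_ (.sub rfl (.pass rfl ?_
      (.sub rfl (.generalize fun m₂ e₂ => ?_))))))
    · simp [h₁.phase, h₁.one, Phase.code]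
    · simp [h₁.phase, h₁.one, Phase.code]
    have h₂ : Ready X q .pos σ.used σ m₂ := by
      rw [e₂]
      exact ((h₁.scratch _).scratch _).scratch _
    have hc₂ : m₂ 2 = I.cls := by simp [e₂, hc]
    have hn₂ : m₂ 3 = I.num := by simp [e₂, hn]
    have hd₂ : m₂ 11 = I.cls - 4 := by simp [e₂, hc, h₁.four]
    clear e₂ h₁ hc hn
    simp only [Scan.step, hph]
    by_cases hgt : 4 < I.cls
    · rw [if_neg (by omega)]
      exact .jump rfl (by omega) (leads_reject h₂.zero)
    refine .pass rfl (by omega) (.sub rfl (.generalize fun m₃ e₃ => ?_))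
    have h₃ : Ready X q .pos σ.used σ m₃ := by
      rw [e₃]
      exact h₂.scratch _
    have hn₃ : m₃ 3 = I.num := by simp [e₃, hn₂]
    have hd₃ : m₃ 11 = 4 - I.cls := by simp [e₃, hc₂, h₂.four]
    by_cases h4 : I.cls = 4
    · rw [if_pos h4]
      refine .pass rfl (by omega) (.const rfl (.jump rfl (by simp [h₃.one]) ?_))
      refine (leads_test (h₃.set_phase 3) ?_).mono (by decide)
      simp [hn₃, num_of_cls (Or.inl h4)]
    · rw [if_neg h4]
      exact .jump rfl (by omega) (leads_reject h₃.zero)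
  · rw [hph] at h₁
    refine .jump rfl (by rw [h₁.phase]; decide) (.sub rfl (.jump rfl ?_ (.sub rfl (.jump rfl ?_
      (.const rfl (.sub rfl (.generalize fun m₂ e₂ => ?_)))))))
    · simp [h₁.phase, h₁.one, Phase.code]
    · simp [h₁.phase, h₁.one, Phase.code]
    have h₂ : Ready X q .opt σ.used σ m₂ := by
      rw [e₂]
      exact (((h₁.scratch _).scratch _).scratch _).scratch _
    have hc₂ : m₂ 2 = I.cls := by simp [e₂, hc]
    have hn₂ : m₂ 3 = I.num := by simp [e₂, hn]
    have hd₂ : m₂ 11 = I.cls - 5 := by simp [e₂, hc]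
    clear e₂ h₁ hc hn
    simp only [Scan.step, hph]
    by_cases hle : I.cls ≤ 5
    · rw [if_neg (by omega)]
      refine .pass rfl (by omega) ?_
      cases hu : σ.used with
      | true => exact .jump rfl (by rw [h₂.used, hu]; simp) (leads_reject h₂.zero)
      | false =>
        refine .pass rfl (by rw [h₂.used, hu]; simp) (.const rfl (.jump rfl ?_ ?_))
        · simp [h₂.one]
        · exact (leads_action (u := true) (h₂.set_used 1) (by simp [hc₂]) (by simp [hn₂])
            hlen).mono (by decide)
    · refine .jump rfl (by omega) (.sub rfl ?_)
      by_cases h6 : I.cls = 6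
      · rw [if_pos h6]
        refine .pass rfl (by simp [hd₂, h₂.one, h6]) (.const rfl ?_)
        refine (leads_test ((h₂.scratch _).set_phase 1) ?_).mono (by decide)
        simp [hn₂, num_of_cls (Or.inr h6)]
      · rw [if_neg h6]
        have h7 : I.cls = 7 := by omega
        refine .jump rfl (by simp [hd₂, h₂.one, h7]) ?_
        have : (if σ.used = true then none else σ.action I true) = none := by
          simp [Scan.action, Scan.kindOf, h7]
        rw [this]
        exact leads_reject (by simp [h₂.zero])

/-- The program has halted, with the output that says whether `A` holds. -/
def Decided (A : Prop) (c : Config) : Prop :=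
  prog[c.pc]? = some .halt ∧ ((A ∧ c.output = [1]) ∨ (¬ A ∧ c.output = [0]))

theorem leads_decided_of_not {A : Prop} {N : ℕ} {m : ℕ → ℤ} (h : m 16 = 0) (hA : ¬ A) :
    Leads prog (N + 1) ⟨43, m, [], []⟩ (Decided A) :=
  .print rfl (.done ⟨rfl, Or.inr ⟨hA, by simp [h]⟩⟩)

theorem leads_decided {X : List PInstr} {σ : Scan} {m : ℕ → ℤ} (h : Holds X 0 σ m) :
    Leads prog 12 ⟨29, m, [], []⟩ (Decided σ.Accepts) := by
  refine .sub rfl (.pass rfl ?_ (.sub rfl (.generalize fun m₁ e₁ => ?_)))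
  · simp [h.ptr, h.base]
  have h₁ : Mem X 0 σ.phase.code (if σ.used then 1 else 0) σ.cur σ.seen.card σ.mx
      (kindsFrom 0 σ.kinds) σ.seen m₁ := by
    rw [e₁]
    exact (h.scratch _).scratch _
  have hd : m₁ 11 = σ.mx - σ.seen.card := by simp [e₁, h.mx, h.cnt]
  clear e₁ h
  by_cases hle : σ.mx ≤ σ.seen.card
  swap
  · exact .jump rfl (by omega) (leads_decided_of_not h₁.zero fun ha => hle ha.2)
  refine .pass rfl (by omega) (.sub rfl (.generalize fun m₂ e₂ => ?_))
  have h₂ : Mem X 0 σ.phase.code (if σ.used then 1 else 0) σ.cur σ.seen.card σ.mx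
      (kindsFrom 0 σ.kinds) σ.seen m₂ := by
    rw [e₂]
    exact h₁.scratch _
  have hd₂ : m₂ 11 = σ.phase.code - 1 := by simp [e₂, h₁.phase, h₁.one]
  clear e₂ h₁ hd
  rcases hph : σ.phase <;> rw [hph] at h₂ hd₂
  · refine .pass rfl (by rw [hd₂]; decide) (.pass rfl (by rw [h₂.phase]; decide)
      (.jump rfl (by simp [h₂.one]) (leads_decided_of_not h₂.zero fun ha => ?_)))
    simp [Scan.Accepts, hph] at ha
  · refine .pass rfl (by rw [hd₂]; decide) (.jump rfl (by rw [h₂.phase]; decide)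
      (.print rfl (.done ⟨rfl, Or.inl ⟨⟨Or.inl hph, hle⟩, by simp [h₂.one]⟩⟩)))
  · refine .jump rfl (by rw [hd₂]; decide) (.sub rfl (.pass rfl ?_ (.jump rfl ?_
      (leads_decided_of_not ?_ fun ha => ?_))))
    · simp [hd₂, h₂.one, Phase.code]
    · simp [h₂.one]
    · simp [h₂.zero]
    · simp [Scan.Accepts, hph] at ha
  · refine .jump rfl (by rw [hd₂]; decide) (.sub rfl (.jump rfl ?_ ?_))
    · simp [hd₂, h₂.one, Phase.code]
    cases hu : σ.used with
    | true =>
      refine .jump rfl ?_ (leads_decided_of_not ?_ fun ha => ?_)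
      · simp [h₂.used, hu]
      · simp [h₂.zero]
      · simp [Scan.Accepts, hph, hu] at ha
    | false =>
      refine .pass rfl ?_ (.print rfl (.done ⟨rfl, Or.inl ⟨⟨Or.inr ⟨hph, hu⟩, hle⟩, ?_⟩⟩))
      · simp [h₂.used, hu]
      · simp [h₂.one]

theorem exists_scan_drop {X : List PInstr} {σ : Scan} (h : scan X = some σ) (q : ℕ) :
    ∃ τ, scan (X.drop q) = some τ := by
  induction X generalizing q σ with
  | nil => exact ⟨σ, by simpa using h⟩
  | cons I X ih =>
    cases q with
    | zero => exact ⟨σ, h⟩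
    | succ q =>
      rw [scan, Option.bind_eq_some_iff] at h
      obtain ⟨τ, hτ, -⟩ := h
      exact ih hτ q

/-- The second loop of the program decides whether the instruction sequence is accepted. -/
theorem leads_decided_scan {X : List PInstr} {q : ℕ} {σ : Scan} {m : ℕ → ℤ} (hq : q ≤ X.length)
    (hσ : scan (X.drop q) = some σ) (h : Holds X q σ m) :
    Leads prog (60 * q + 12) ⟨29, m, [], []⟩ (Decided (∃ σ, scan X = some σ ∧ σ.Accepts)) := by
  induction q generalizing σ m with
  | zero =>
    rw [List.drop_zero] at hσ
    simpa [hσ] using leads_decided h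
  | succ q ih =>
    have hI : X[q]? = some X[q] := List.getElem?_eq_getElem (by omega)
    have hlen := (scan_wf hσ).length_kinds
    rw [List.length_drop] at hlen
    have hdrop : scan (X.drop q) = σ.step X[q] := by
      rw [List.drop_eq_getElem_cons (by omega), scan, hσ, Option.bind_some]
    refine ((leads_step h hI (by omega)).trans (M := 60 * q + 12) ?_).mono (by omega)
    rintro d ⟨m', hd⟩
    rcases hs : σ.step X[q] with _ | τ <;> rw [hs] at hd hdrop
    · obtain ⟨rfl, hm⟩ := hd
      refine leads_decided_of_not hm ?_
      rintro ⟨τ, hτ, -⟩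
      obtain ⟨τ', hτ'⟩ := exists_scan_drop hτ q
      rw [hdrop] at hτ'
      simp at hτ'
    · obtain ⟨rfl, hm⟩ := hd
      exact ih (by omega) hdrop hm

/-- The contents of the registers below `X₄₀` after the initialization, apart from the pointer. They
do not change in the first loop of the program, apart from those of `X₁`, `X₂`, `X₃` and `X₁₁`. -/
def constants : List ℤ :=
  [0, 0, 0, 0, 0, 0, 0, 0, 0, 1, 4, 0, 0, 2, 0, 40, 0, 17, 0, 0, 1, 0, 0, 0, 4, 3, 1, 3, 3, 0, 6, 0,
    2, 0, 0, 3, 5, 7, 0, 0]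

/-- The class of an instruction can be looked up by its form. -/
theorem exists_form (I : PInstr) : ∃ f : ℕ, 0 < f ∧ f ≤ 20 ∧ I.code = [(f : ℤ), I.num] ∧
    constants.getD (17 + f) 0 = I.cls := by
  refine ⟨(I.code.headD 0).toNat, ?_⟩
  rcases I with a | a | a | l | _ <;> try rcases a with i | (_ | _) | i | ⟨i, (_ | _)⟩
  all_goals exact ⟨Nat.le_of_ble_eq_true rfl, Nat.le_of_ble_eq_true rfl, rfl, rfl⟩

/-- The contents of the registers after `p` instructions have been read from the input tape. -/
structure Loading (X : List PInstr) (p : ℕ) (m : ℕ → ℤ) : Prop where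
  ptr : m 0 = (40 + 4 * p : ℕ)
  const : ∀ i < 40, i ∉ [0, 1, 2, 3, 11] → m i = constants.getD i 0
  cls : ∀ r < p, ∀ I, X[r]? = some I → m (40 + 4 * r) = I.cls
  num : ∀ r < p, ∀ I, X[r]? = some I → m (41 + 4 * r) = I.num
  kind : ∀ r, m (42 + 4 * r) = 0
  seen : ∀ x, m (43 + 4 * x) = 0

theorem Loading.update {X : List PInstr} {p : ℕ} {m : ℕ → ℤ} (h : Loading X p m) {I : PInstr}
    (hI : X[p]? = some I) {c x y v₁ v₂ v₃ v₁₁ v₁₁' : ℤ} (hc : c = I.cls) (hx : x = I.num)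
    (hy : y = (40 + 4 * (p + 1) : ℕ)) :
    Loading X (p + 1) (Function.update (Function.update (Function.update (Function.update
      (Function.update (Function.update (Function.update (Function.update m 1 v₁) 11 v₁₁) 2 v₂)
        3 v₃) (40 + 4 * p) c) 11 v₁₁') (41 + 4 * p) x) 0 y) := by
  have e : Function.update (Function.update (Function.update (Function.update
      (Function.update (Function.update (Function.update (Function.update m 1 v₁) 11 v₁₁) 2 v₂)
        3 v₃) (40 + 4 * p) c) 11 v₁₁') (41 + 4 * p) x) 0 y =
      fun i => if i = 0 then y else if i = 1 then v₁ else if i = 2 then v₂ else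
        if i = 3 then v₃ else if i = 11 then v₁₁' else
        if i = 40 + 4 * p then c else if i = 41 + 4 * p then x else m i := by
    funext i
    simp only [Function.update_apply]
    split_ifs <;> first | rfl | omega
  rw [e, hc, hx, hy]
  constructor
  · simp
  · intro i hi hne
    simp only [List.mem_cons, List.not_mem_nil, not_or, or_false] at hne
    obtain ⟨h0, h1, h2, h3, h4⟩ := hne
    rw [if_neg h0, if_neg h1, if_neg h2, if_neg h3, if_neg h4, if_neg (by omega),
      if_neg (by omega)]
    exact h.const i hi (by simp [*])
  · intro r hr J hJ
    iterate 5 rw [if_neg (by omega)]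
    by_cases hrp : r = p
    · subst hrp
      rw [hI, Option.some_inj] at hJ
      rw [if_pos rfl, hJ]
    · rw [if_neg (by omega), if_neg (by omega), h.cls r (by omega) J hJ]
  · intro r hr J hJ
    iterate 6 rw [if_neg (by omega)]
    by_cases hrp : r = p
    · subst hrp
      rw [hI, Option.some_inj] at hJ
      rw [if_pos rfl, hJ]
    · rw [if_neg (by omega), h.num r (by omega) J hJ]
  · intro r
    iterate 7 rw [if_neg (by omega)]
    exact h.kind r
  · intro r
    iterate 7 rw [if_neg (by omega)]
    exact h.seen r

/-- One round of the first loop of the program stores one instruction. -/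
theorem leads_store {X : List PInstr} {p : ℕ} {m : ℕ → ℤ} {I : PInstr} {w : List ℤ}
    (h : Loading X p m) (hI : X[p]? = some I) :
    Leads prog 10 ⟨17, m, I.code ++ w, []⟩
      (fun d => ∃ m', d = ⟨17, m', w, []⟩ ∧ Loading X (p + 1) m') := by
  obtain ⟨f, hf0, hf20, hcode, hcls⟩ := exists_form I
  have h9 : m 9 = 1 := h.const 9 (by decide) (by decide)
  have h10 : m 10 = 4 := h.const 10 (by decide) (by decide)
  have h17 : m 17 = 17 := h.const 17 (by decide) (by decide)
  have hmf : m (17 + f) = I.cls := by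
    rw [h.const _ (by omega) (by simp; omega), hcls]
  rw [hcode]
  refine .read rfl (.jump rfl ?_ (.add rfl (.load (a := 17 + f) rfl ?_ (.read rfl
    (.store (a := 40 + 4 * p) rfl ?_ (.add rfl (.store (a := 41 + 4 * p) rfl ?_ (.add rfl
    (.jump rfl ?_ (.done ⟨_, rfl, ?_⟩))))))))))
  · simpa using hf0
  · simp [h17]; ring
  · simp [h.ptr]
  · have h0 : (0 : ℕ) ≠ 40 + 4 * p := by omega
    have h9' : (9 : ℕ) ≠ 40 + 4 * p := by omega
    simp [h.ptr, h9, Function.update_of_ne h0, Function.update_of_ne h9']; ring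
  · have h9' : (9 : ℕ) ≠ 40 + 4 * p := by omega
    have h9'' : (9 : ℕ) ≠ 41 + 4 * p := by omega
    simp [h9, Function.update_of_ne h9', Function.update_of_ne h9'']
  · have hne : ∀ i, i < 40 → i ≠ 40 + 4 * p ∧ i ≠ 41 + 4 * p := by omega
    refine h.update hI ?_ ?_ ?_
    · rw [Function.update_of_ne (by decide), Function.update_self,
        Function.update_of_ne (by omega), Function.update_of_ne (by omega), hmf]
    · simp [Function.update_of_ne (hne 3 (by decide)).1]
    · simp [Function.update_of_ne (hne 0 (by decide)).1,
        Function.update_of_ne (hne 0 (by decide)).2,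
        Function.update_of_ne (hne 10 (by decide)).1,
        Function.update_of_ne (hne 10 (by decide)).2, h.ptr, h10]
      ring

/-- The first loop of the program stores the instruction sequence. -/
theorem leads_load {X : List PInstr} {p : ℕ} {m : ℕ → ℤ} (h : Loading X p m)
    (hp : p ≤ X.length) :
    Leads prog (10 * (X.length - p) + 5) ⟨17, m, encode (X.drop p), []⟩
      (fun d => ∃ m', d = ⟨29, m', [], []⟩ ∧
        Holds X X.length ⟨.term, false, 0, [], ∅, 0⟩ m') := by
  induction hk : X.length - p generalizing p m with
  | zero =>
    obtain rfl : p = X.length := by omega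
    have hc : ∀ i < 40, i ∉ [0, 1, 2, 3, 11] → m i = constants.getD i 0 := h.const
    have h16 : m 16 = 0 := hc 16 (by decide) (by decide)
    have h9 : m 9 = 1 := hc 9 (by decide) (by decide)
    rw [List.drop_length]
    refine .read rfl (.pass rfl (by simp) (.add rfl (.jump rfl (by simp [h9])
      (.done ⟨_, rfl, ?_⟩))))
    constructor
    case cls =>
      intro r I hr
      have : r < X.length := (List.getElem?_eq_some_iff.1 hr).1
      rw [update_add_mul_of_lt _ _ _ (by decide), update_add_mul_of_lt _ _ _ (by decide),
        h.cls r this I hr]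
    case num =>
      intro r I hr
      have : r < X.length := (List.getElem?_eq_some_iff.1 hr).1
      rw [update_add_mul_of_lt _ _ _ (by decide), update_add_mul_of_lt _ _ _ (by decide),
        h.num r this I hr]
    case kind =>
      intro r
      rw [update_add_mul_of_lt _ _ _ (by decide), update_add_mul_of_lt _ _ _ (by decide), h.kind]
      simp [kindsFrom]
    case seen =>
      intro r
      rw [update_add_mul_of_lt _ _ _ (by decide), update_add_mul_of_lt _ _ _ (by decide), h.seen]
      simp
    case ptr => simp [h.ptr]
    case fin => simp [h.ptr, h16]
    all_goals
      rw [Function.update_of_ne (by decide), Function.update_of_ne (by decide),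
        hc _ (by decide) (by decide)]
      rfl
  | succ k ih =>
    have hI : X[p]? = some X[p] := List.getElem?_eq_getElem (by omega)
    have henc : encode (X.drop p) = X[p].code ++ encode (X.drop (p + 1)) := by
      rw [encode, List.drop_eq_getElem_cons (by omega), List.flatMap_cons, List.append_assoc]
      rfl
    rw [henc]
    refine ((leads_store h hI).trans (M := 10 * k + 5) ?_).mono (by omega)
    rintro d ⟨m', rfl, h'⟩
    exact ih h' (by omega) (by omega)

theorem leads_init {X : List PInstr} :
    Leads prog 17 (RAM.init (encode X))
      (fun d => ∃ m', d = ⟨17, m', encode X, []⟩ ∧ Loading X 0 m') := by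
  refine .const rfl (.const rfl (.const rfl (.const rfl (.const rfl (.const rfl (.const rfl
    (.const rfl (.const rfl (.const rfl (.const rfl (.const rfl (.const rfl (.const rfl (.const rfl
    (.const rfl (.const rfl (.done ⟨_, rfl, ?_⟩)))))))))))))))))
  constructor
  · simp
  · intro i hi hne
    simp only [List.mem_cons, List.not_mem_nil, not_or, or_false] at hne
    interval_cases i <;> first | rfl | omega
  · intro r hr; omega
  · intro r hr; omega
  · intro r; simp [update_add_mul_of_lt]
  · intro r; simp [update_add_mul_of_lt]

/-- The program decides whether an instruction sequence is accepted, in linear time. -/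
theorem decidesWithin_accepts (X : List PInstr) :
    DecidesWithin prog (encode X) (∃ σ, scan X = some σ ∧ σ.Accepts) (70 * X.length + 34) := by
  obtain ⟨t, ht, c, hc, hd⟩ : Leads prog (17 + (10 * X.length + 5 + (60 * X.length + 12)))
      (RAM.init (encode X)) (Decided (∃ σ, scan X = some σ ∧ σ.Accepts)) := by
    refine leads_init.trans ?_
    rintro d ⟨m, rfl, hm⟩
    refine Leads.trans (leads_load hm (Nat.zero_le _)) ?_
    rintro d ⟨m', rfl, hm'⟩
    exact leads_decided_scan le_rfl (by rw [List.drop_length]; rfl) hm'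
  exact ⟨t, by omega, c, hc, hd⟩

end InSeq

/-- There is a RAM that decides, in time `O(n²)` under the uniform cost criterion, whether an
instruction sequence `X` with the same length as `TSTNZ'_n` computes the `n`-bit non-zeroness
test, for `n ≥ 1`. -/
theorem mainTheorem3 :
    ∃ (P : List RAM.Instr) (T : ℕ → ℕ),
      (fun n : ℕ => (T n : ℝ)) =O[Filter.atTop] (fun n : ℕ => (n : ℝ) ^ 2) ∧
      ∀ n : ℕ, 1 ≤ n → ∀ X : List InSeq.PInstr, X.length = (InSeq.tstnz' n).length →
        RAM.DecidesWithin P (InSeq.encode X) (InSeq.Computes X (InSeq.nzt n)) (T n) := by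
  refine ⟨InSeq.prog, fun n => 70 * (InSeq.tstnz' n).length + 34, ?_, fun n hn X hl => ?_⟩
  · -- `70 * (3 * n + 3) / 2 + 34 ≤ 105 * n + 139 ≤ 244 * n ^ 2`
    refine Asymptotics.IsBigO.of_bound 244 ?_
    filter_upwards [Filter.eventually_ge_atTop 1] with n hn
    rw [Real.norm_natCast, Real.norm_of_nonneg (by positivity)]
    have hlen : 70 * (InSeq.tstnz' n).length + 34 ≤ 244 * n ^ 2 := by
      have h := InSeq.two_mul_length_tstnz' n
      have hle : 2 * (InSeq.tstnz' n).length ≤ 3 * n + 3 := by split_ifs at h <;> omega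
      nlinarith
    exact_mod_cast hlen
  · beta_reduce
    rw [InSeq.computes_iff_accepts hn hl, ← hl]
    exact InSeq.decidesWithin_accepts X
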